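/- **Setting.** Let $r\ge 0$ and $a_0,\dots,a_r\in\mathbb R$. Independent variables are $t=(t_n)_{n\in\mathbb Z}$ with $t_0=x$; $\epsilon$ is a formal parameter, and all fields are formal power series in $\epsilon$ whose coefficients are real functions of $t$. Fix a set $J\subset\mathbb Z$ with $0\in J$ ($J=\mathbb Z$ gives the whole hierarchy); "open" and "smooth" mean open, respectively $C^\infty$, in any finitely many of the variables $t_n$, $n\in J$, the others being frozen. Let $D$ be an open domain in this sense whose intersection with every line parallel to the $x$-axis is an interval (possibly empty). Given fields $w^0,\dots,w^{r-1}$ smooth on $D$, put $w^r=1$, $\hat A=\sum_{i=0}^r w^i\lambda^i$, $\hat a=\sum_{i=0}^r a_i\lambda^i$. Let $b=1+b_1\lambda^{-1}+b_2\lambda^{-2}+\cdots$ and $c=c_0+c_1\lambda+c_2\lambda^2+\cdots$ (smooth coefficients, $c_0$ with positive leading coefficient in $\epsilon$) be determined by $$\hat A b^2-\tfrac{\epsilon^2}{4}\hat a\,(2bb_{xx}-b_x^2)=\lambda^r,\qquad \hat A c^2-\tfrac{\epsilon^2}{4}\hat a\,(2cc_{xx}-c_x^2)=1,$$ and put $B_n=(\lambda^n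 b)_+$ for $n\ge0$ (non-negative powers of $\lambda$) and $B_n=(\lambda^n c)_-$ for $n<0$ (negative powers of $\lambda$). The $n$-th flow of the $r$-KdV-CH hierarchy with parameters $(a_0,\dots,a_r)$ is $$\hat A_{t_n}=2\hat A\,B_{n,x}+\hat A_x B_n-\tfrac{\epsilon^2}{2}\hat a\,B_{n,xxx},$$ called the $n$-th positive flow if $n>0$ and the $|n|$-th negative flow if $n<0$. **Theorem.** Let $w^0,\dots,w^{r-1}$ be a solution on $D$ of the flows $n\in J$ of the hierarchy with parameters $(a_0,\dots,a_r)$. Put $\alpha_0=\frac1{c_0}$, $\alpha_n=\frac{b_n}{c_0}$ for $n>0$ and $\alpha_n=-\frac{c_{-n}}{c_0}$ for $n<0$, that is, consider $$\alpha=\frac1{c_0}\Big(dx+\sum_{n>0}b_n\,dt_n-\sum_{n<0}c_{-n}\,dt_n\Big),$$ restricted to $n\in J$. Then: 1. $\alpha$ is closed: $\partial_{t_m}\alpha_n=\partial_{t_n}\alpha_m$ on $D$ for all $m,n\in J$; and if $D$ is convex there is a smooth $y$ on $D$ with $dy=\alpha$. 2. Let $y$ be any smooth field on $D$ with $dy=\alpha$,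 i.e. $\partial_{t_n}y=\alpha_n$ for $n\in J$, and let $(y,s)$ with $s_0=y$, $s_n=t_{-n}$ $(n\ne0)$ be the reciprocal variables. At order $\epsilon^0$ the map $(x,t)\mapsto(y,s)$ is injective on $D$ with open image $D'$ (open in the variables $s_n$, $-n\in J$), and there are fields $v^0,\dots,v^{r-1}$, smooth on $D'$ and unique there, such that, with $v^r=1$, $$v^{r-i}(y,s)=c_0^2\,w^i-\tfrac{\epsilon^2}{4}a_i\,(2c_0c_{0,xx}-c_{0,x}^2)\qquad(i=0,\dots,r),$$ where $y=y(x,t;\epsilon)$ is substituted on the left as a formal power series in $\epsilon$ (Taylor expansion about its leading term). 3. The fields $v^0,\dots,v^{r-1}$, as functions of the space variable $y$ and the times $s_n$, are a solution on $D'$ of the flows $-n$, $n\in J$, of the $r$-KdV-CH hierarchy with the reversed parameters $(a_r,a_{r-1},\dots,a_0)$. Thus a solution of the whole hierarchy ($J=\mathbb Z$) gives a solution of the whole reversed hierarchy, and the $n$-th positive flow (time $t_n$, $n>0$) becomes the $n$-th negative flow (time $s_{-n}=t_n$), and vice versa. -/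

import Mathlib

open scoped ContDiff

noncomputable section

namespace RKdVCH

/-! ## Independent variables, smooth functions, and formal series in the dispersion parameter -/

/-- A point is the collection of all independent variables, indexed by `ℤ`. For the original
hierarchy the coordinate `0` is the space variable `x = t₀` and the coordinate `n ≠ 0` is the time
`tₙ`; for the transformed hierarchy they are `y = s₀` and `sₙ`. -/
abbrev Pt := ℤ → ℝ

/-- `D` is open in the variables with index in `J`: each slice of `D` obtained by moving finitely
many of these variables and freezing all the others is open. -/
def FinOpen (J : Set ℤ) (D : Set Pt) : Prop :=
  ∀ (F : Finset ℤ), (F : Set ℤ) ⊆ J → ∀ t : Pt,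
    IsOpen {u : F → ℝ | Function.updateFinset t F u ∈ D}

/-- `f` is smooth on `D` as a function of any finitely many of the variables with index in `J`. -/
def SmoothFun (J : Set ℤ) (D : Set Pt) (f : Pt → ℝ) : Prop :=
  ∀ (F : Finset ℤ), (F : Set ℤ) ⊆ J → ∀ t : Pt,
    ContDiffOn ℝ ∞ (fun u : F → ℝ => f (Function.updateFinset t F u))
      {u : F → ℝ | Function.updateFinset t F u ∈ D}

/-- The partial derivative of a function with respect to the `n`-th variable. -/
def pd (n : ℤ) (f : Pt → ℝ) : Pt → ℝ :=
  fun t => deriv (fun u : ℝ => f (Function.update t n u)) (t n)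

/-- A field: a formal power series `∑ εᵏ fₖ` in `ε` whose coefficients are functions of the
independent variables. -/
abbrev Fld := PowerSeries (Pt → ℝ)

/-- The formal parameter `ε`. -/
def eps : Fld := PowerSeries.X

/-- All coefficients of the field are smooth on `D`. -/
def Smooth (J : Set ℤ) (D : Set Pt) (f : Fld) : Prop :=
  ∀ k, SmoothFun J D (PowerSeries.coeff k f)

/-- Two fields coincide on `D`, order by order in `ε`. -/
def Agree (D : Set Pt) (f g : Fld) : Prop :=
  ∀ k, Set.EqOn (PowerSeries.coeff k f) (PowerSeries.coeff k g) D

/-- The derivative of a field with respect to the `n`-th variable; `d 0` is `∂ₓ`. -/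
def d (n : ℤ) (f : Fld) : Fld :=
  PowerSeries.mk fun k => pd n (PowerSeries.coeff k f)

/-- The reciprocal `1 / f` of a field, taken at each point in the ring `ℝ⟦ε⟧` of power series (it is
the inverse of `f` at the points where the leading coefficient of `f` does not vanish). -/
def recip (f : Fld) : Fld :=
  PowerSeries.mk fun k t =>
    PowerSeries.coeff k (PowerSeries.map (Pi.evalRingHom (fun _ : Pt => ℝ) t) f)⁻¹

/-! ## The hierarchy -/

/-- The coefficients `wⁱ` of `Â`, for all `i : ℤ`: the unknowns `w⁰, …, wʳ⁻¹`, then `wʳ = 1`, and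
`wⁱ = 0` for `i < 0` or `i > r`. -/
def wc {r : ℕ} (w : Fin r → Fld) (i : ℤ) : Fld :=
  if h : 0 ≤ i ∧ i < r then w ⟨i.toNat, by omega⟩ else if i = r then 1 else 0

/-- The coefficients `aᵢ` of `â`, for all `i : ℤ`, with `aᵢ = 0` for `i < 0` or `i > r`. -/
def ac {r : ℕ} (a : Fin (r + 1) → ℝ) (i : ℤ) : ℝ :=
  if h : 0 ≤ i ∧ i < r + 1 then a ⟨i.toNat, by omega⟩ else 0

/-- Generating series: power series in one auxiliary variable (`λ` or `λ⁻¹`) over the fields. -/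
abbrev Gen := PowerSeries Fld

/-- The coefficientwise `∂ₓ` on generating series. -/
def dx (F : Gen) : Gen := PowerSeries.mk fun j => d 0 (PowerSeries.coeff j F)

/-- Coefficientwise coincidence of generating series on `D`. -/
def GenAgree (D : Set Pt) (F G : Gen) : Prop :=
  ∀ j, Agree D (PowerSeries.coeff j F) (PowerSeries.coeff j G)

/-- The quadratic expression `P F² - (ε² / 4) Q (2 F Fₓₓ - Fₓ²)`. -/
def quad (P Q F : Gen) : Gen :=
  P * F ^ 2 -
    PowerSeries.C ((1 / 4 : ℝ) • eps ^ 2) * Q * (2 * F * dx (dx F) - dx F ^ 2)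

/-- `b = 1 + b₁ λ⁻¹ + b₂ λ⁻² + ⋯` solves `Â b² - (ε² / 4) â (2 b bₓₓ - bₓ²) = λʳ` on `D`.
Here `b` is a power series in `λ⁻¹` and the equation is divided by `λʳ`, so that `λ⁻ʳ Â` and
`λ⁻ʳ â` are the power series in `λ⁻¹` with coefficients `wʳ⁻ʲ` and `aᵣ₋ⱼ`. -/
def IsPositiveSeries {r : ℕ} (J : Set ℤ) (D : Set Pt) (a : Fin (r + 1) → ℝ) (w : Fin r → Fld)
    (b : Gen) : Prop :=
  (∀ j, Smooth J D (PowerSeries.coeff j b)) ∧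
  Agree D (PowerSeries.coeff 0 b) 1 ∧
  GenAgree D
    (quad (PowerSeries.mk fun j => wc w ((r : ℤ) - j))
      (PowerSeries.mk fun j => ac a ((r : ℤ) - j) • (1 : Fld)) b) 1

/-- `c = c₀ + c₁ λ + c₂ λ² + ⋯` solves `Â c² - (ε² / 4) â (2 c cₓₓ - cₓ²) = 1` on `D`, with the
branch `c₀ = 1 / √w⁰ + O(ε)`, that is, with positive leading coefficient. -/
def IsNegativeSeries {r : ℕ} (J : Set ℤ) (D : Set Pt) (a : Fin (r + 1) → ℝ) (w : Fin r → Fld)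
    (c : Gen) : Prop :=
  (∀ j, Smooth J D (PowerSeries.coeff j c)) ∧
  (∀ t ∈ D, 0 < PowerSeries.coeff 0 (PowerSeries.coeff 0 c) t) ∧
  GenAgree D
    (quad (PowerSeries.mk fun j => wc w j)
      (PowerSeries.mk fun j => ac a j • (1 : Fld)) c) 1

/-- The coefficient of `λᵐ` in `Bₙ`, where `Bₙ = (λⁿ b)₊` for `n ≥ 0` and `Bₙ = (λⁿ c)₋` for
`n < 0`. -/
def Bc (b c : Gen) (n m : ℤ) : Fld :=
  if 0 ≤ n then
    if 0 ≤ m ∧ m ≤ n then PowerSeries.coeff (n - m).toNat b else 0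
  else
    if n ≤ m ∧ m < 0 then PowerSeries.coeff (m - n).toNat c else 0

/-- The operator `𝒟ᵢ = 2 wⁱ ∂ₓ + wⁱₓ - (ε² / 2) aᵢ ∂ₓ³`. -/
def Dop {r : ℕ} (a : Fin (r + 1) → ℝ) (w : Fin r → Fld) (i : ℤ) (f : Fld) : Fld :=
  2 * wc w i * d 0 f + d 0 (wc w i) * f -
    (1 / 2 * ac a i : ℝ) • (eps ^ 2 * d 0 (d 0 (d 0 f)))

/-- The flow `∂_{tₙ}` on `D`: the equation
`Â_{tₙ} = 2 Â Bₙₓ + Âₓ Bₙ - (ε² / 2) â Bₙₓₓₓ`, coefficient by coefficient in `λ`. -/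
def SolvesFlow {r : ℕ} (D : Set Pt) (a : Fin (r + 1) → ℝ) (w : Fin r → Fld) (b c : Gen)
    (n : ℤ) : Prop :=
  ∀ k : ℤ, Agree D (d n (wc w k))
    (∑ i ∈ Finset.range (r + 1), Dop a w (i : ℤ) (Bc b c n (k - i)))

/-- `w⁰, …, wʳ⁻¹` is a solution on `D` of the flows `∂_{tₙ}`, `n ∈ J`, of the `r`-KdV-CH hierarchy
with parameters `(a₀, …, aᵣ)`. For `J = ℤ` it is a solution of the hierarchy. The two series `b`
and `c` are determined on `D` by `w`, recursively in the powers of `λ` and `ε`. -/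
def IsSolution {r : ℕ} (J : Set ℤ) (D : Set Pt) (a : Fin (r + 1) → ℝ) (w : Fin r → Fld) : Prop :=
  (∀ i, Smooth J D (w i)) ∧
  ∃ b c : Gen, IsPositiveSeries J D a w b ∧ IsNegativeSeries J D a w c ∧
    ∀ n ∈ J, SolvesFlow D a w b c n

/-! ## The reciprocal transformation -/

/-- The components of the one-form `α = (1 / c₀) (dx + ∑_{n>0} bₙ dtₙ - ∑_{n<0} c₋ₙ dtₙ)`. -/
def alpha (b c : Gen) (n : ℤ) : Fld :=
  recip (PowerSeries.coeff 0 c) *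
    (if n = 0 then 1
      else if 0 < n then PowerSeries.coeff n.toNat b
      else -PowerSeries.coeff (-n).toNat c)

/-- `y` is a reciprocal space variable: `dy = α` (in the variables with index in `J`). -/
def IsReciprocalVariable (J : Set ℤ) (D : Set Pt) (b c : Gen) (y : Fld) : Prop :=
  Smooth J D y ∧ ∀ n ∈ J, Agree D (d n y) (alpha b c n)

/-- The index set of the new times: `sₙ = t₋ₙ`. -/
def negTimes (J : Set ℤ) : Set ℤ := {n | -n ∈ J}

/-- The change of variables `(x, t) ↦ (y, s)`, `sₙ = t₋ₙ` for `n ≠ 0`, at order `ε⁰`. -/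
def newPoint (y : Fld) (t : Pt) : Pt :=
  fun n => if n = 0 then PowerSeries.coeff 0 y t else t (-n)

/-- The field `f(y, s)` written in the old variables, `f(y(x, t; ε), s)`: the formal power series in
`ε` given by the Taylor expansion `∑ⱼ (1 / j!) (∂_yʲ f)(y₀, s) (y - y₀)ʲ` at the leading part `y₀`
of `y`. As `y - y₀` is divisible by `ε`, only the terms with `j ≤ k` contribute to `εᵏ`. -/
def inOldVariables (y f : Fld) : Fld :=
  PowerSeries.mk fun k t =>
    ∑ j ∈ Finset.range (k + 1), ∑ p ∈ Finset.HasAntidiagonal.antidiagonal k,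
      (1 / (j.factorial : ℝ)) *
        ((pd 0)^[j] (PowerSeries.coeff p.1 f)) (newPoint y t) *
        PowerSeries.coeff p.2 ((y - PowerSeries.C (PowerSeries.coeff 0 y)) ^ j) t

/-- The expression `c₀² wⁱ - (ε² / 4) aᵢ (2 c₀ c₀ₓₓ - c₀ₓ²)`. -/
def transformed {r : ℕ} (a : Fin (r + 1) → ℝ) (w : Fin r → Fld) (c₀ : Fld) (i : ℤ) : Fld :=
  c₀ ^ 2 * wc w i -
    (1 / 4 * ac a i : ℝ) • (eps ^ 2 * (2 * c₀ * d 0 (d 0 c₀) - d 0 c₀ ^ 2))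

/-- The functions `v⁰, …, vʳ⁻¹` of `(y, s)` satisfy
`vʳ⁻ⁱ(y, s) = c₀² wⁱ - (ε² / 4) aᵢ (2 c₀ c₀ₓₓ - c₀ₓ²)` for `i = 0, …, r`, where `vʳ = 1`. -/
def IsTransform {r : ℕ} (J : Set ℤ) (D : Set Pt) (a : Fin (r + 1) → ℝ) (w : Fin r → Fld)
    (c y : Fld) (v : Fin r → Fld) : Prop :=
  (∀ i, Smooth (negTimes J) (newPoint y '' D) (v i)) ∧
  ∀ i : ℕ, i ≤ r →
    Agree D (inOldVariables y (wc v ((r : ℤ) - i))) (transformed a w c (i : ℤ))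

end RKdVCH

end

/-! Put γ = c₀ and βₙ = bₙ for n ≥ 0 (with b₀ = 1), βₙ = -c₋ₙ for n < 0, so that αₙ = βₙ / γ. Write
W(f, g) = f gₓ - fₓ g.

Evolution of b and c. The quadratic expression behaves as a scalar when F has the weight of a vector
field and Â moves by the flow of X = Bₙ. Hence X Fₓ - Xₓ F is the evolution compatible with the
quadratic equation for F = b or F = c. The deviation e of the true evolution from it satisfies a
linear equation e = (ε² / 4) T e, because Â F is invertible, and so e = 0 order by order in ε
(`series_flow`). Expanding in λ gives sums of Wronskians. Their antisymmetry leaves γ_{tₙ} = W(βₙ,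
γ) and ∂_{tₘ} βₙ - ∂_{tₙ} βₘ = W(βₘ, βₙ) (`Fields.c_zero_flow`, `Fields.beta_flow`), which together
amount to closedness of α (`Fields.closed`). The Poincaré lemma, applied on finite-dimensional
slices, supplies y on a convex domain (`pd_potential`).

Change of variables. The leading part of y is strictly increasing in x, so at order ε⁰ the map is
injective and, on slices containing x, a diffeomorphism onto its image. The Taylor expansion in the
remainder of y extends the pull-back to an isomorphism Φ of rings of formal series
(`exists_formal`), which gives existence and uniqueness of v. Under Φ, ∂_y becomes γ ∂ₓ and, for n ≠
0, ∂_{s₋ₙ} becomes ∂_{tₙ} - βₙ ∂ₓ.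

Covariance. Under ∂ ↦ γ ∂ the quadratic equations and the operators 𝒟ᵢ keep their form, with wⁱ
replaced by γ² wⁱ - (ε² / 4) aᵢ (2 γ γₓₓ - γₓ²). Reading λ as λ⁻¹ then exchanges the two series: b'
= c / γ and c' = b / γ (`Transforms.quad_gen`). The truncations defining Bₙ correspond except at λ⁰
(`Transforms.map_bc`), and this discrepancy is exactly the term -βₙ ∂ₓ in the transformed time
derivative (`Transforms.flow`). -/

noncomputable section

namespace RKdVCH

/-! ## Differential algebra of generating series -/

section CoefficientwiseDerivation

variable {R : Type*} [CommRing R] [Algebra ℝ R]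

/-- The derivation of a power series ring acting on each coefficient. -/
def mapDer (δ : Derivation ℝ R R) : Derivation ℝ (PowerSeries R) (PowerSeries R) :=
  Derivation.mk'
    { toFun := fun f => PowerSeries.mk fun k => δ (PowerSeries.coeff k f)
      map_add' := fun f g => by ext k; simp
      map_smul' := fun c f => by ext k; simp }
    (fun f g => by
      ext k
      simp [PowerSeries.coeff_mul, Finset.sum_add_distrib, Derivation.leibniz]
      exact Finset.sum_nbij' Prod.swap Prod.swap (by simp [add_comm]) (by simp [add_comm])
        (by simp) (by simp) (by simp))

@[simp] lemma coeff_mapDer (δ : Derivation ℝ R R) (f : PowerSeries R) (k : ℕ) :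
    PowerSeries.coeff k (mapDer δ f) = δ (PowerSeries.coeff k f) := by
  simp [mapDer]

@[simp] lemma mapDer_C (δ : Derivation ℝ R R) (f : R) :
    mapDer δ (PowerSeries.C f) = PowerSeries.C (δ f) := by
  ext k
  simp only [coeff_mapDer, PowerSeries.coeff_C]
  split_ifs <;> simp

@[simp] lemma mapDer_X (δ : Derivation ℝ R R) : mapDer δ (PowerSeries.X : PowerSeries R) = 0 := by
  ext k
  simp only [coeff_mapDer, PowerSeries.coeff_X]
  split_ifs <;> simp

lemma mapDer_comm (δ δ' : Derivation ℝ R R) (h : ∀ f, δ (δ' f) = δ' (δ f)) (f : PowerSeries R) :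
    mapDer δ (mapDer δ' f) = mapDer δ' (mapDer δ f) := by
  ext k
  simp [h]

end CoefficientwiseDerivation

/-! ### Linearization of the quadratic equation along a flow -/

section Flow

variable {G : Type*} [CommRing G]

/-- The quadratic expression `P F² - κ Q (2 F F'' - F'²)` in a differential ring. -/
def quadD [Algebra ℝ G] (δ : Derivation ℝ G G) (κ P Q F : G) : G :=
  P * F ^ 2 - κ * Q * (2 * F * δ (δ F) - δ F ^ 2)

/-- If `P` moves along the flow generated by `X`, the error `e = F_t - (X F' - X' F)` of the
evolution of a solution `F` of the quadratic equation satisfies the linearized equation. -/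
lemma linearized_error [Algebra ℝ G] (δ τ : Derivation ℝ G G) (hcomm : ∀ f, δ (τ f) = τ (δ f))
    {κ P Q F X z : G} (hκ : δ κ = 0) (hκτ : τ κ = 0) (hQ : δ Q = 0) (hQτ : τ Q = 0)
    (hz : δ z = 0)
    (hquad : quadD δ κ P Q F = 1)
    (hflow : z * τ P = 2 * P * δ X + δ P * X - 2 * κ * Q * δ (δ (δ X))) {e : G}
    (he : e = z * τ F - (X * δ F - δ X * F)) :
    2 * e * (P * F) = κ * (Q * (2 * e * δ (δ F) + 2 * F * δ (δ e) - 2 * δ F * δ e)) := by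
  have h2 (D : Derivation ℝ G G) : D 2 = 0 := by simpa using D.map_natCast 2
  have h1 := congrArg δ hquad
  have h3 := congrArg τ hquad
  simp only [quadD, map_sub, Derivation.leibniz, Derivation.leibniz_pow, Derivation.map_one_eq_zero,
    smul_eq_mul, hκ, hκτ, hQ, hQτ, nsmul_eq_mul, h2] at h1 h3
  rw [← hcomm, ← hcomm] at h3
  -- Substituting this into z τ(quad) - X δ(quad) = 0 cancels every term without `e`, since the
  -- expected evolution changes the scalar `quadD` only by X δ(quad). As δ z = 0, the factor `z`
  -- passes through the space derivatives.
  have hτF : z * τ F = e + (X * δ F - δ X * F) := by rw [he]; ring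
  have hτF' := congrArg δ hτF
  have hτF'' := congrArg δ hτF'
  simp only [map_add, map_sub, Derivation.leibniz, smul_eq_mul, hz] at hτF' hτF''
  push_cast at h1 h3
  simp only [pow_one, mul_zero, zero_mul, map_zero, add_zero] at *
  linear_combination z * h3 - F ^ 2 * hflow - 2 * P * F * hτF - X * h1 + κ * Q *
     (2 * δ (δ F) * hτF + 2 * F * hτF'' - 2 * δ F * hτF')

end Flow

/-! ### Uniqueness by ε-adic iteration -/

section Uniqueness

open PowerSeries

variable {R : Type*} [CommRing R] [Algebra ℝ R]

/-- The constant `ε² / 4` as a generating series. -/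
def quarterEpsSq (R : Type*) [CommRing R] [Algebra ℝ R] : PowerSeries (PowerSeries R) :=
  C ((1 / 4 : ℝ) • (X : PowerSeries R) ^ 2)

@[simp] lemma mapDer_quarterEpsSq (δ : Derivation ℝ R R) :
    mapDer (mapDer δ) (quarterEpsSq R) = 0 := by
  simp [quarterEpsSq, Derivation.leibniz_pow]

lemma isUnit_one_add_quarterEpsSq_mul (Y : PowerSeries (PowerSeries R)) :
    IsUnit (1 + quarterEpsSq R * Y) := by
  rw [PowerSeries.isUnit_iff_constantCoeff, PowerSeries.isUnit_iff_constantCoeff]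
  simp [quarterEpsSq, PowerSeries.constantCoeff_smul]

/-- Iterating the equation makes `e` divisible by every power of ε², and only 0 has this property.
-/
lemma eq_zero_of_eq_quarterEpsSq_mul {T : PowerSeries (PowerSeries R) → PowerSeries (PowerSeries R)}
    (hT : ∀ f, T (quarterEpsSq R * f) = quarterEpsSq R * T f) {e : PowerSeries (PowerSeries R)}
    (he : e = quarterEpsSq R * T e) : e = 0 := by
  have key : ∀ k : ℕ, ∃ f, e = quarterEpsSq R ^ k * f ∧ f = T^[k] e := by
    intro k
    induction k with
    | zero => exact ⟨e, by simp, rfl⟩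
    | succ k ih =>
      obtain ⟨f, hf, hfk⟩ := ih
      refine ⟨T f, ?_, by rw [hfk, ← Function.iterate_succ_apply' T]⟩
      have hTk : ∀ m : ℕ, T (quarterEpsSq R ^ m * f) = quarterEpsSq R ^ m * T f := by
        intro m
        induction m with
        | zero => simp
        | succ m ihm => rw [pow_succ', mul_assoc, hT, ihm, mul_assoc]
      rw [he, hf, hTk]
      ring
  ext j k
  obtain ⟨f, hf, -⟩ := key (k + 1)
  rw [hf, quarterEpsSq, ← map_pow, coeff_C_mul, smul_pow, smul_mul_assoc, ← pow_mul, coeff_smul,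
    coeff_X_pow_mul', if_neg (by omega)]
  simp

/-- A solution of the quadratic equation is a unit. -/
lemma isUnit_mul_of_quadD {δ : Derivation ℝ R R} {P Q F : PowerSeries (PowerSeries R)}
    (hquad : quadD (mapDer (mapDer δ)) (quarterEpsSq R) P Q F = 1) : IsUnit (P * F * F) := by
  have h : P * F * F = 1 + quarterEpsSq R *
      (Q * (2 * F * mapDer (mapDer δ) (mapDer (mapDer δ) F) - mapDer (mapDer δ) F ^ 2)) := by
    rw [← hquad, quadD]
    ring
  rw [h]
  exact isUnit_one_add_quarterEpsSq_mul _

/-- The evolution `F_t = X F' - X' F` of a solution of the quadratic equation `quadD P Q F = 1` when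
`P` moves along the flow generated by `X`; the factor `z` clears the negative powers in `X`. -/
lemma series_flow (δ τ : Derivation ℝ R R) (hcomm : ∀ f, δ (τ f) = τ (δ f))
    {P Q F Y z : PowerSeries (PowerSeries R)}
    (hQ : mapDer (mapDer δ) Q = 0) (hQτ : mapDer (mapDer τ) Q = 0) (hz : mapDer (mapDer δ) z = 0)
    (hquad : quadD (mapDer (mapDer δ)) (quarterEpsSq R) P Q F = 1)
    (hflow : z * mapDer (mapDer τ) P = 2 * P * mapDer (mapDer δ) Y + mapDer (mapDer δ) P * Y -
      2 * quarterEpsSq R * Q * mapDer (mapDer δ) (mapDer (mapDer δ) (mapDer (mapDer δ) Y))) :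
    z * mapDer (mapDer τ) F = Y * mapDer (mapDer δ) F - mapDer (mapDer δ) Y * F := by
  have hU := isUnit_mul_of_quadD hquad
  have hlin := linearized_error (mapDer (mapDer δ)) (mapDer (mapDer τ))
    (mapDer_comm _ _ (mapDer_comm _ _ hcomm)) (mapDer_quarterEpsSq δ) (mapDer_quarterEpsSq τ)
    hQ hQτ hz hquad hflow rfl
  set e := z * mapDer (mapDer τ) F - (Y * mapDer (mapDer δ) F - mapDer (mapDer δ) Y * F)
  obtain ⟨V, hV⟩ := ((isUnit_of_mul_isUnit_left hU).exists_right_inv)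
  set half : PowerSeries (PowerSeries R) := algebraMap ℝ _ (1 / 2) with hhalf
  have h2 : half * 2 = 1 := by
    have : (2 : PowerSeries (PowerSeries R)) = algebraMap ℝ _ 2 := (map_ofNat _ 2).symm
    rw [this, hhalf, ← map_mul]
    norm_num
  -- Dividing the linearized equation by the unit 2 P F, where `V` inverts P F, brings it to the
  -- form e = (ε² / 4) T e. The operator T commutes with ε² / 4 because this constant is annihilated
  -- by the derivations.
  have he : e = 0 := by
    refine eq_zero_of_eq_quarterEpsSq_mul (T := fun f => half * V * (Q * (2 * f *
      mapDer (mapDer δ) (mapDer (mapDer δ) F) + 2 * F * mapDer (mapDer δ) (mapDer (mapDer δ) f) -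
      2 * mapDer (mapDer δ) F * mapDer (mapDer δ) f))) (fun f => ?_) ?_
    · simp only [Derivation.leibniz, smul_eq_mul, mapDer_quarterEpsSq, mul_zero, add_zero]
      ring
    · linear_combination half * V * hlin - 2 * half * e * hV - e * h2
  exact sub_eq_zero.mp he

end Uniqueness

/-! ## The hierarchy over a differential ring -/

section AbstractHierarchy

open PowerSeries

variable {R : Type*} [CommRing R] [Algebra ℝ R]

/-- The operator `2 w ∂ₓ + wₓ - (ε² / 2) α ∂ₓ³` over a differential ring. -/
def dopD (δ : Derivation ℝ R R) (α : ℝ) (w f : PowerSeries R) : PowerSeries R :=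
  2 * w * mapDer δ f + mapDer δ w * f -
    (1 / 2 * α : ℝ) • ((X : PowerSeries R) ^ 2 * mapDer δ (mapDer δ (mapDer δ f)))

/-- The coefficient of `λᵐ` in `Bₙ`. -/
def bcD {S : Type*} [CommRing S] (b c : PowerSeries S) (n m : ℤ) : S :=
  if 0 ≤ n then
    if 0 ≤ m ∧ m ≤ n then coeff (n - m).toNat b else 0
  else
    if n ≤ m ∧ m < 0 then coeff (m - n).toNat c else 0

/-- The numerators `βₙ = c₀ αₙ` of the one-form `α`. -/
def betaD {S : Type*} [CommRing S] (b c : PowerSeries S) (n : ℤ) : S :=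
  if 0 ≤ n then coeff n.toNat b else -coeff (-n).toNat c

/-- The Wronskian `f gₓ - fₓ g`. -/
def wronskian (δ : Derivation ℝ R R) (f g : PowerSeries R) : PowerSeries R :=
  f * mapDer δ g - mapDer δ f * g

lemma wronskian_swap (δ : Derivation ℝ R R) (f g : PowerSeries R) :
    wronskian δ g f = -wronskian δ f g := by
  simp only [wronskian]; ring

@[simp] lemma wronskian_zero_left (δ : Derivation ℝ R R) (g : PowerSeries R) :
    wronskian δ 0 g = 0 := by
  simp [wronskian]

@[simp] lemma wronskian_neg_left (δ : Derivation ℝ R R) (f g : PowerSeries R) :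
    wronskian δ (-f) g = -wronskian δ f g := by
  simp only [wronskian, map_neg]; ring

@[simp] lemma wronskian_neg_right (δ : Derivation ℝ R R) (f g : PowerSeries R) :
    wronskian δ f (-g) = -wronskian δ f g := by
  simp only [wronskian, map_neg]; ring

@[simp] lemma dopD_zero_right (δ : Derivation ℝ R R) (α : ℝ) (w : PowerSeries R) :
    dopD δ α w 0 = 0 := by
  simp [dopD]

@[simp] lemma dopD_zero_zero (δ : Derivation ℝ R R) (f : PowerSeries R) :
    dopD δ 0 0 f = 0 := by
  simp [dopD]

/-- The coefficients `W i`, `a i` and the series `b`, `c` of the hierarchy. -/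
structure Fields (δ : Derivation ℝ R R) (r : ℕ) (a : ℤ → ℝ) (W : ℤ → PowerSeries R)
    (b c : PowerSeries (PowerSeries R)) : Prop where
  a_eq_zero : ∀ i, i < 0 ∨ (r : ℤ) < i → a i = 0
  W_eq_zero : ∀ i, i < 0 ∨ (r : ℤ) < i → W i = 0
  b_zero : coeff 0 b = 1
  quad_b : quadD (mapDer (mapDer δ)) (quarterEpsSq R) (mk fun j => W ((r : ℤ) - j))
    (mk fun j => a ((r : ℤ) - j) • (1 : PowerSeries R)) b = 1
  quad_c : quadD (mapDer (mapDer δ)) (quarterEpsSq R) (mk fun j => W j)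
    (mk fun j => a j • (1 : PowerSeries R)) c = 1

/-- The derivation `τ` is the `n`-th flow. -/
def IsFlow (δ τ : Derivation ℝ R R) (r : ℕ) (a : ℤ → ℝ) (W : ℤ → PowerSeries R)
    (b c : PowerSeries (PowerSeries R)) (n : ℤ) : Prop :=
  ∀ k : ℤ, mapDer τ (W k) =
    ∑ i ∈ Finset.range (r + 1), dopD δ (a i) (W i) (bcD b c n (k - i))

/-- This passes from the flow given coefficient by coefficient to the single identity required by
`series_flow`. The sequence `y` lists the coefficients of Bₙ after multiplication by the power `N`
of the series variable that removes its negative powers. -/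
lemma generating_flow (δ τ : Derivation ℝ R R) (p : ℕ → PowerSeries R) (q : ℕ → ℝ)
    (y : ℕ → PowerSeries R) (N : ℕ)
    (h : ∀ k, coeff k ((X : PowerSeries (PowerSeries R)) ^ N * mapDer (mapDer τ) (mk p)) =
      ∑ x ∈ Finset.HasAntidiagonal.antidiagonal k, dopD δ (q x.1) (p x.1) (y x.2)) :
    X ^ N * mapDer (mapDer τ) (mk p) =
      2 * mk p * mapDer (mapDer δ) (mk y) + mapDer (mapDer δ) (mk p) * mk y -
        2 * quarterEpsSq R * (mk fun j => q j • (1 : PowerSeries R)) *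
          mapDer (mapDer δ) (mapDer (mapDer δ) (mapDer (mapDer δ) (mk y))) := by
  have h2 : (2 : PowerSeries (PowerSeries R)) = C 2 := (map_ofNat _ 2).symm
  ext1 k
  rw [h, h2, quarterEpsSq, ← map_mul, mul_assoc, mul_assoc, map_sub, map_add, coeff_C_mul,
    coeff_C_mul, coeff_mul, coeff_mul, coeff_mul, Finset.mul_sum, Finset.mul_sum,
    ← Finset.sum_add_distrib, ← Finset.sum_sub_distrib]
  refine Finset.sum_congr rfl fun x _ => ?_
  simp only [dopD, coeff_mk, coeff_mapDer, smul_mul_assoc, mul_smul_comm, one_mul, smul_smul]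
  congr 1
  · ring
  · have : (2 : PowerSeries R) = (2 : ℝ) • 1 := by
      rw [← Algebra.algebraMap_eq_smul_one, map_ofNat]
    rw [this]
    simp only [smul_mul_assoc, one_mul, smul_smul]
    congr 1
    ring

lemma coeff_flow (δ τ : Derivation ℝ R R) (y : ℕ → PowerSeries R) (F : PowerSeries (PowerSeries R))
    (N q : ℕ)
    (h : X ^ N * mapDer (mapDer τ) F =
      mk y * mapDer (mapDer δ) F - mapDer (mapDer δ) (mk y) * F) :
    mapDer τ (coeff q F) = ∑ i ∈ Finset.range (q + N + 1), wronskian δ (y i)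
      (coeff (q + N - i) F) := by
  have := congrArg (coeff (q + N)) h
  rw [coeff_X_pow_mul, coeff_mapDer] at this
  rw [this, map_sub, coeff_mul, coeff_mul, ← Finset.sum_sub_distrib,
    Finset.Nat.sum_antidiagonal_eq_sum_range_succ_mk]
  simp [wronskian]

variable {δ τ : Derivation ℝ R R} {r : ℕ} {a : ℤ → ℝ} {W : ℤ → PowerSeries R}
  {b c : PowerSeries (PowerSeries R)}

lemma mapDer_mk_smul_one (τ : Derivation ℝ R R) (q : ℕ → ℝ) :
    mapDer (mapDer τ) (mk fun j => q j • (1 : PowerSeries R)) = 0 := by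
  ext1 k; simp

/-- The series variable is λ. Only flows with n < 0 have negative powers in Bₙ, down to λⁿ, so the
clearing power is `(-n).toNat`. -/
lemma Fields.c_flow (hF : Fields δ r a W b c) (hcomm : ∀ f, δ (τ f) = τ (δ f)) {n : ℤ}
    (hτ : IsFlow δ τ r a W b c n) (q : ℕ) :
    mapDer τ (coeff q c) = ∑ i ∈ Finset.range (q + (-n).toNat + 1),
      wronskian δ (bcD b c n (i - (-n).toNat)) (coeff (q + (-n).toNat - i) c) := by
  refine coeff_flow δ τ (fun i => bcD b c n (i - (-n).toNat)) c (-n).toNat q ?_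
  refine series_flow δ τ hcomm (mapDer_mk_smul_one _ fun j : ℕ => a j)
    (mapDer_mk_smul_one _ fun j : ℕ => a j) (by simp [Derivation.leibniz_pow]) hF.quad_c ?_
  refine generating_flow δ τ (fun j => W j) (fun j => a j) _ _ fun k => ?_
  have hl : coeff k ((X : PowerSeries (PowerSeries R)) ^ (-n).toNat *
      mapDer (mapDer τ) (PowerSeries.mk fun j : ℕ => W j)) = mapDer τ (W (k - (-n).toNat)) := by
    rw [coeff_X_pow_mul']
    split_ifs with h
    · rw [coeff_mapDer, coeff_mk, Nat.cast_sub h]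
    · rw [hF.W_eq_zero _ (Or.inl (by omega)), map_zero]
  rw [hl, hτ, Finset.Nat.sum_antidiagonal_eq_sum_range_succ_mk]
  -- The flow sums over 0 ≤ i ≤ r and the product of series over 0 ≤ i ≤ k. Both extend by zero to i
  -- ≤ k + r: beyond r the coefficients aᵢ and wⁱ vanish, beyond k the coefficient of Bₙ does.
  have h1 : ∑ i ∈ Finset.range (r + 1), dopD δ (a i) (W i) (bcD b c n (k - (-n).toNat - i)) =
      ∑ i ∈ Finset.range (k + r + 1), dopD δ (a i) (W i) (bcD b c n (k - (-n).toNat - i)) := by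
    refine Finset.sum_subset (Finset.range_mono (by omega)) fun i _ hi => ?_
    rw [Finset.mem_range] at hi
    rw [hF.a_eq_zero _ (Or.inr (by omega)), hF.W_eq_zero _ (Or.inr (by omega)), dopD_zero_zero]
  have h2 : ∑ i ∈ Finset.range (k + 1), dopD δ (a i) (W i) (bcD b c n (k - (-n).toNat - i)) =
      ∑ i ∈ Finset.range (k + r + 1), dopD δ (a i) (W i) (bcD b c n (k - (-n).toNat - i)) := by
    refine Finset.sum_subset (Finset.range_mono (by omega)) fun i _ hi => ?_
    rw [Finset.mem_range] at hi
    have : bcD b c n (k - (-n).toNat - i) = 0 := by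
      unfold bcD
      split_ifs <;> first | omega | rfl
    rw [this, dopD_zero_right]
  rw [h1, ← h2]
  refine Finset.sum_congr rfl fun i hi => ?_
  rw [Finset.mem_range] at hi
  rw [show (k : ℤ) - (-n).toNat - i = ((k - i : ℕ) : ℤ) - (-n).toNat by omega]

/-- The same argument in the variable λ⁻¹: now positive powers of λ must be cleared, whence
`n.toNat`, and the coefficients of Â are read backwards, i ↦ r - i. -/
lemma Fields.b_flow (hF : Fields δ r a W b c) (hcomm : ∀ f, δ (τ f) = τ (δ f)) {n : ℤ}
    (hτ : IsFlow δ τ r a W b c n) (q : ℕ) :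
    mapDer τ (coeff q b) = ∑ i ∈ Finset.range (q + n.toNat + 1),
      wronskian δ (bcD b c n (n.toNat - i)) (coeff (q + n.toNat - i) b) := by
  refine coeff_flow δ τ (fun i => bcD b c n (n.toNat - i)) b n.toNat q ?_
  refine series_flow δ τ hcomm (mapDer_mk_smul_one _ fun j : ℕ => a (r - j))
    (mapDer_mk_smul_one _ fun j : ℕ => a (r - j)) (by simp [Derivation.leibniz_pow]) hF.quad_b ?_
  refine generating_flow δ τ (fun j => W (r - j)) (fun j => a (r - j)) _ _ fun k => ?_
  have hl : coeff k ((X : PowerSeries (PowerSeries R)) ^ n.toNat *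
      mapDer (mapDer τ) (PowerSeries.mk fun j : ℕ => W (r - j))) = mapDer τ (W (r - k + n.toNat)) := by
    rw [coeff_X_pow_mul']
    split_ifs with h
    · rw [coeff_mapDer, coeff_mk, Nat.cast_sub h, sub_add]
    · rw [hF.W_eq_zero _ (Or.inr (by omega)), map_zero]
  rw [hl, hτ, Finset.Nat.sum_antidiagonal_eq_sum_range_succ_mk, ← Finset.sum_range_reflect]
  have h0 : ∑ j ∈ Finset.range (r + 1), dopD δ (a ((r + 1 - 1 - j : ℕ) : ℤ))
      (W ((r + 1 - 1 - j : ℕ) : ℤ))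
      (bcD b c n (r - k + n.toNat - ((r + 1 - 1 - j : ℕ) : ℤ))) =
      ∑ i ∈ Finset.range (r + 1), dopD δ (a (r - i)) (W (r - i)) (bcD b c n (n.toNat - k + i)) := by
    refine Finset.sum_congr rfl fun i hi => ?_
    rw [Finset.mem_range] at hi
    rw [show ((r + 1 - 1 - i : ℕ) : ℤ) = r - i by omega]
    congr 2
    ring
  have h1 : ∑ i ∈ Finset.range (r + 1), dopD δ (a (r - i)) (W (r - i)) (bcD b c n (n.toNat - k + i))
      = ∑ i ∈ Finset.range (k + r + 1), dopD δ (a (r - i)) (W (r - i))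
        (bcD b c n (n.toNat - k + i)) := by
    refine Finset.sum_subset (Finset.range_mono (by omega)) fun i _ hi => ?_
    rw [Finset.mem_range] at hi
    rw [hF.a_eq_zero _ (Or.inl (by omega)), hF.W_eq_zero _ (Or.inl (by omega)), dopD_zero_zero]
  have h2 : ∑ i ∈ Finset.range (k + 1), dopD δ (a (r - i)) (W (r - i)) (bcD b c n (n.toNat - k + i))
      = ∑ i ∈ Finset.range (k + r + 1), dopD δ (a (r - i)) (W (r - i))
        (bcD b c n (n.toNat - k + i)) := by
    refine Finset.sum_subset (Finset.range_mono (by omega)) fun i _ hi => ?_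
    rw [Finset.mem_range] at hi
    have : bcD b c n (n.toNat - k + i) = 0 := by
      unfold bcD
      split_ifs <;> first | omega | rfl
    rw [this, dopD_zero_right]
  rw [h0, h1, ← h2]
  refine Finset.sum_congr rfl fun i hi => ?_
  rw [Finset.mem_range] at hi
  rw [show (n.toNat : ℤ) - ((k - i : ℕ) : ℤ) = n.toNat - k + i by omega]

end AbstractHierarchy

/-! ### Wronskian sums and closedness of the one-form -/

section Closedness

open PowerSeries

/-- The sum over 0, …, m + n vanishes by antisymmetry, and its last n + 1 terms are the negatives of
the first n + 1. This compares two flows whose Wronskian sums have the same general term but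
different lengths. -/
lemma sum_range_eq_of_antisymm {S : Type*} [AddCommGroup S] [Module ℝ S] (g : ℕ → S) (m n : ℕ)
    (hg : ∀ i ≤ m + n, g (m + n - i) = -g i) :
    ∑ i ∈ Finset.range m, g i = ∑ i ∈ Finset.range (n + 1), g i := by
  have h1 : ∑ i ∈ Finset.range (m + n + 1), g i = -∑ i ∈ Finset.range (m + n + 1), g i := by
    conv_lhs => rw [← Finset.sum_range_reflect]
    rw [← Finset.sum_neg_distrib]
    refine Finset.sum_congr rfl fun i hi => ?_
    rw [Finset.mem_range] at hi
    rw [← hg i (by omega)]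
    congr 1
  have h2 : ∑ i ∈ Finset.range (m + n + 1), g i = 0 := by
    have h3 : (2 : ℝ) • ∑ i ∈ Finset.range (m + n + 1), g i = 0 := by
      rw [two_smul]
      nth_rewrite 2 [h1]
      exact add_neg_cancel _
    simpa using h3
  rw [add_assoc, Finset.sum_range_add] at h2
  have h4 : ∑ i ∈ Finset.range (n + 1), g (m + i) = -∑ i ∈ Finset.range (n + 1), g i := by
    rw [← Finset.sum_range_reflect, ← Finset.sum_neg_distrib]
    refine Finset.sum_congr rfl fun i hi => ?_
    rw [Finset.mem_range] at hi
    rw [← hg i (by omega)]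
    congr 1
    omega
  rwa [h4, ← sub_eq_add_neg, sub_eq_zero] at h2

variable {R : Type*} [CommRing R] [Algebra ℝ R] {δ τ σ : Derivation ℝ R R} {r : ℕ} {a : ℤ → ℝ}
  {W : ℤ → PowerSeries R} {b c : PowerSeries (PowerSeries R)}

lemma wronskian_antisymm (F : PowerSeries (PowerSeries R)) (s i : ℕ) (hi : i ≤ s) :
    wronskian δ (coeff (s - i) F) (coeff (s - (s - i)) F) =
      -wronskian δ (coeff i F) (coeff (s - i) F) := by
  rw [Nat.sub_sub_self hi, wronskian_swap]

lemma Fields.b_flow_of_nonneg (hF : Fields δ r a W b c) (hcomm : ∀ f, δ (τ f) = τ (δ f)) {n : ℕ}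
    (hτ : IsFlow δ τ r a W b c n) (q : ℕ) :
    mapDer τ (coeff q b) = ∑ i ∈ Finset.range (n + 1),
      wronskian δ (coeff i b) (coeff (n + q - i) b) := by
  rw [hF.b_flow hcomm hτ q, Int.toNat_natCast]
  symm
  rw [add_comm q n]
  trans ∑ i ∈ Finset.range (n + 1),
      wronskian δ (bcD b c n ((n : ℤ) - i)) (coeff (n + q - i) b)
  · refine Finset.sum_congr rfl fun i hi => ?_
    rw [Finset.mem_range] at hi
    rw [bcD, if_pos (by omega), if_pos (by omega)]
    congr 3
    omega
  · refine Finset.sum_subset (Finset.range_mono (by omega)) fun i _ hi => ?_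
    rw [Finset.mem_range] at hi
    rw [bcD, if_pos (by omega), if_neg (by omega), wronskian_zero_left]

lemma Fields.c_flow_of_neg (hF : Fields δ r a W b c) (hcomm : ∀ f, δ (τ f) = τ (δ f)) {p : ℕ}
    (hp : 0 < p) (hτ : IsFlow δ τ r a W b c (-p)) (q : ℕ) :
    mapDer τ (coeff q c) = ∑ i ∈ Finset.range p,
      wronskian δ (coeff i c) (coeff (p + q - i) c) := by
  rw [hF.c_flow hcomm hτ q, neg_neg, Int.toNat_natCast]
  symm
  rw [add_comm q p]
  trans ∑ i ∈ Finset.range p,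
      wronskian δ (bcD b c (-p) ((i : ℤ) - p)) (coeff (p + q - i) c)
  · refine Finset.sum_congr rfl fun i hi => ?_
    rw [Finset.mem_range] at hi
    rw [bcD, if_neg (by omega), if_pos (by omega)]
    congr 3
    omega
  · refine Finset.sum_subset (Finset.range_mono (by omega)) fun i _ hi => ?_
    rw [Finset.mem_range] at hi
    rw [bcD, if_neg (by omega), if_neg (by omega), wronskian_zero_left]

/-- The sum is padded with zeros so that, after removal of its term i = 0, it has the same range as
the sum in `Fields.b_flow_of_neg` with the roles of the indices exchanged. -/
lemma Fields.c_flow_of_nonneg (hF : Fields δ r a W b c) (hcomm : ∀ f, δ (τ f) = τ (δ f)) {n : ℕ}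
    (hτ : IsFlow δ τ r a W b c n) (q : ℕ) :
    mapDer τ (coeff q c) = ∑ i ∈ Finset.range (q + n + 1), if i ≤ n ∧ i ≤ q then
      wronskian δ (coeff (n - i) b) (coeff (q - i) c) else 0 := by
  rw [hF.c_flow hcomm hτ q, show (-(n : ℤ)).toNat = 0 by omega]
  trans ∑ i ∈ Finset.range (q + 1), if i ≤ n ∧ i ≤ q then
      wronskian δ (coeff (n - i) b) (coeff (q - i) c) else 0
  · refine Finset.sum_congr (by simp) fun i hi => ?_
    rw [Finset.mem_range] at hi
    unfold bcD
    rw [if_pos (by omega)]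
    by_cases h : i ≤ n
    · rw [if_pos (by omega), if_pos (by omega), add_zero]
      congr 3
      omega
    · rw [if_neg (by omega), if_neg (by omega), wronskian_zero_left]
  · refine Finset.sum_subset (Finset.range_mono (by omega)) fun i _ hi => ?_
    rw [Finset.mem_range] at hi
    rw [if_neg (by omega)]

lemma Fields.b_flow_of_neg (hF : Fields δ r a W b c) (hcomm : ∀ f, δ (τ f) = τ (δ f)) {p : ℕ}
    (hp : 0 < p) (hτ : IsFlow δ τ r a W b c (-p)) (q : ℕ) :
    mapDer τ (coeff q b) = ∑ i ∈ Finset.range (p + q), if i + 1 ≤ q ∧ i + 1 ≤ p then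
      wronskian δ (coeff (p - (i + 1)) c) (coeff (q - (i + 1)) b) else 0 := by
  rw [hF.b_flow hcomm hτ q, show (-(p : ℤ)).toNat = 0 by omega, Finset.sum_range_succ', bcD,
    if_neg (by omega), if_neg (by omega), wronskian_zero_left, add_zero]
  trans ∑ i ∈ Finset.range (q + 0), if i + 1 ≤ q ∧ i + 1 ≤ p then
      wronskian δ (coeff (p - (i + 1)) c) (coeff (q - (i + 1)) b) else 0
  · refine Finset.sum_congr rfl fun i hi => ?_
    rw [Finset.mem_range] at hi
    unfold bcD
    rw [if_neg (by omega)]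
    by_cases h : i + 1 ≤ p
    · rw [if_pos (by omega), if_pos (by omega), add_zero]
      congr 3
      omega
    · rw [if_neg (by omega), if_neg (by omega), wronskian_zero_left]
  · refine Finset.sum_subset (Finset.range_mono (by omega)) fun i _ hi => ?_
    rw [Finset.mem_range] at hi
    rw [if_neg (by omega)]

/-- The leading coefficient `c₀` evolves by `c₀_t = βₙ c₀ₓ - βₙₓ c₀`. -/
lemma Fields.c_zero_flow (hF : Fields δ r a W b c) (hcomm : ∀ f, δ (τ f) = τ (δ f)) {n : ℤ}
    (hτ : IsFlow δ τ r a W b c n) :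
    mapDer τ (coeff 0 c) = wronskian δ (betaD b c n) (coeff 0 c) := by
  rcases le_or_gt 0 n with h | h
  · obtain ⟨n, rfl⟩ := Int.eq_ofNat_of_zero_le h
    rw [hF.c_flow_of_nonneg hcomm hτ, Finset.sum_range_succ', Finset.sum_eq_zero]
    · simp [betaD]
    · intro i _
      rw [if_neg (by omega)]
  · obtain ⟨p, rfl⟩ : ∃ p : ℕ, n = -p := ⟨(-n).toNat, by omega⟩
    rw [hF.c_flow_of_neg hcomm (by omega) hτ, betaD, if_neg (by omega),
      sum_range_eq_of_antisymm (fun i => wronskian δ (coeff i c) (coeff (p + 0 - i) c)) p 0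
        (fun i hi => wronskian_antisymm c _ i hi)]
    simp
    rw [wronskian_swap]

/-- The truncations (λᵐ b)₊ and (λ⁻ᵖ c)₋ produce the same Wronskians with opposite signs, except
that the term i = 0 occurs only in the evolution of `c`. -/
lemma Fields.mixed_flow (hF : Fields δ r a W b c)
    (hτ : ∀ f, δ (τ f) = τ (δ f)) (hσ : ∀ f, δ (σ f) = σ (δ f)) {m p : ℕ} (hp : 0 < p)
    (hm : IsFlow δ τ r a W b c m) (hn : IsFlow δ σ r a W b c (-p)) :
    mapDer τ (coeff p c) + mapDer σ (coeff m b) = wronskian δ (coeff m b) (coeff p c) := by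
  rw [hF.c_flow_of_nonneg hτ hm, hF.b_flow_of_neg hσ hp hn, Finset.sum_range_succ',
    add_right_comm, ← Finset.sum_add_distrib, Finset.sum_eq_zero]
  · simp
  · intro i _
    by_cases h : i + 1 ≤ m ∧ i + 1 ≤ p
    · rw [if_pos h, if_pos h, wronskian_swap]
      simp
    · rw [if_neg h, if_neg h, add_zero]

/-- The evolutions of the `βₙ` are compatible. -/
lemma Fields.beta_flow (hF : Fields δ r a W b c)
    (hτ : ∀ f, δ (τ f) = τ (δ f)) (hσ : ∀ f, δ (σ f) = σ (δ f)) {m n : ℤ}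
    (hm : IsFlow δ τ r a W b c m) (hn : IsFlow δ σ r a W b c n) :
    mapDer τ (betaD b c n) - mapDer σ (betaD b c m) =
      wronskian δ (betaD b c m) (betaD b c n) := by
  unfold betaD
  rcases le_or_gt 0 m with h | h <;> rcases le_or_gt 0 n with h' | h'
  · obtain ⟨m, rfl⟩ := Int.eq_ofNat_of_zero_le h
    obtain ⟨n, rfl⟩ := Int.eq_ofNat_of_zero_le h'
    simp only [h, h', if_true, Int.toNat_natCast]
    -- Both evolutions sum W(bᵢ, b_{m+n-i}), one over i ≤ m and the other over i ≤ n. By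
    -- antisymmetry the latter equals the sum over i < m, so the difference is the term i = m.
    rw [hF.b_flow_of_nonneg hτ hm, hF.b_flow_of_nonneg hσ hn, Finset.sum_range_succ, add_comm n m,
      sum_range_eq_of_antisymm (fun i => wronskian δ (coeff i b) (coeff (m + n - i) b)) m n
        (fun i hi => wronskian_antisymm b _ i hi)]
    simp
  · obtain ⟨m, rfl⟩ := Int.eq_ofNat_of_zero_le h
    obtain ⟨p, rfl⟩ : ∃ p : ℕ, n = -p := ⟨(-n).toNat, by omega⟩
    rw [if_neg (by omega), if_pos h]
    simp only [Int.toNat_natCast, neg_neg]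
    rw [map_neg, wronskian_neg_right, ← hF.mixed_flow hτ hσ (by omega) hm hn]
    ring
  · obtain ⟨n, rfl⟩ := Int.eq_ofNat_of_zero_le h'
    obtain ⟨p, rfl⟩ : ∃ p : ℕ, m = -p := ⟨(-m).toNat, by omega⟩
    rw [if_pos h', if_neg (by omega)]
    simp only [Int.toNat_natCast, neg_neg]
    rw [map_neg, wronskian_neg_left, wronskian_swap, ← hF.mixed_flow hσ hτ (by omega) hn hm]
    ring
  · obtain ⟨q, rfl⟩ : ∃ p : ℕ, n = -p := ⟨(-n).toNat, by omega⟩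
    obtain ⟨p, rfl⟩ : ∃ p : ℕ, m = -p := ⟨(-m).toNat, by omega⟩
    rw [if_neg (by omega), if_neg (by omega)]
    simp only [Int.toNat_natCast, neg_neg]
    rw [map_neg, map_neg, wronskian_neg_right, wronskian_neg_left,
      hF.c_flow_of_neg hτ (by omega) hm, hF.c_flow_of_neg hσ (by omega) hn,
      sum_range_eq_of_antisymm (fun i => wronskian δ (coeff i c) (coeff (p + q - i) c)) p q
        (fun i hi => wronskian_antisymm c _ i hi), Finset.sum_range_succ, add_comm q p]
    simp
    rw [wronskian_swap, neg_neg]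

/-- Closedness of the one-form `βₙ / c₀`. -/
lemma Fields.closed (hF : Fields δ r a W b c)
    (hτ : ∀ f, δ (τ f) = τ (δ f)) (hσ : ∀ f, δ (σ f) = σ (δ f)) {m n : ℤ}
    (hm : IsFlow δ τ r a W b c m) (hn : IsFlow δ σ r a W b c n) {u : PowerSeries R}
    (hu : u * coeff 0 c = 1) :
    mapDer τ (u * betaD b c n) = mapDer σ (u * betaD b c m) := by
  have hder (D : Derivation ℝ R R) : mapDer D u = -u ^ 2 * mapDer D (coeff 0 c) := by
    have := congrArg (mapDer D) hu
    simp only [Derivation.leibniz, smul_eq_mul, Derivation.map_one_eq_zero] at this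
    linear_combination u * this - mapDer D u * hu
  rw [Derivation.leibniz, Derivation.leibniz, smul_eq_mul, smul_eq_mul, smul_eq_mul, smul_eq_mul,
    hder, hder, hF.c_zero_flow hτ hm, hF.c_zero_flow hσ hn]
  have hb := hF.beta_flow hτ hσ hm hn
  simp only [wronskian] at hb ⊢
  linear_combination u * hb + u * (betaD b c n * mapDer δ (betaD b c m) -
    betaD b c m * mapDer δ (betaD b c n)) * hu

end Closedness

/-! ## Formal change of variables -/

section Taylor

open PowerSeries

variable {S S' : Type*} [CommRing S] [Algebra ℝ S] [CommRing S'] [Algebra ℝ S']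

/-- The Taylor series `∑ hʲ / j! ϑ(Dʲ f)`. -/
def taylor (D : Derivation ℝ S' S') (ϑ : S' →ₐ[ℝ] S) (f : S') : PowerSeries S :=
  mk fun j => (1 / (j.factorial : ℝ)) • ϑ (D^[j] f)

variable (D : Derivation ℝ S' S') (ϑ : S' →ₐ[ℝ] S)

lemma coeff_taylor_succ (f : S') (j : ℕ) :
    coeff (j + 1) (taylor D ϑ f) * (j + 1) = coeff j (taylor D ϑ (D f)) := by
  have h : ((j : S) + 1) = algebraMap ℝ S (j + 1) := by simp
  rw [h, mul_comm, ← Algebra.smul_def, taylor, taylor, coeff_mk, coeff_mk, smul_smul,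
    Function.iterate_succ_apply, Nat.factorial_succ]
  congr 1
  push_cast
  field_simp

lemma coeff_taylor_zero (f : S') : coeff 0 (taylor D ϑ f) = ϑ f := by
  simp [taylor]

lemma derivative_taylor (f : S') : derivative S (taylor D ϑ f) = taylor D ϑ (D f) := by
  ext1 j
  rw [coeff_derivative, coeff_taylor_succ]

lemma taylor_add (f g : S') : taylor D ϑ (f + g) = taylor D ϑ f + taylor D ϑ g := by
  have h (j : ℕ) : D^[j] (f + g) = D^[j] f + D^[j] g := by
    induction j generalizing f g with
    | zero => rfl
    | succ j ih => simp only [Function.iterate_succ_apply, map_add, ih]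
  ext1 j
  simp [taylor, h]

lemma isUnit_natCast_succ (j : ℕ) : IsUnit ((j : S) + 1) := by
  have h : ((j : S) + 1) = algebraMap ℝ S (j + 1) := by simp
  rw [h]
  exact (isUnit_iff_ne_zero.mpr (by positivity)).map _

/-- Both sides have the same constant term and obey the same Leibniz rule under the formal
derivative, by `derivative_taylor`. Since j + 1 is invertible, coefficient j + 1 is determined by
coefficient j of the derivative. -/
lemma taylor_mul (f g : S') : taylor D ϑ (f * g) = taylor D ϑ f * taylor D ϑ g := by
  ext1 j
  induction j generalizing f g with
  | zero =>
    rw [coeff_taylor_zero, coeff_zero_eq_constantCoeff_apply, map_mul, map_mul,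
      ← coeff_zero_eq_constantCoeff_apply, ← coeff_zero_eq_constantCoeff_apply,
      coeff_taylor_zero, coeff_taylor_zero]
  | succ j ih =>
    refine (isUnit_natCast_succ j).mul_right_cancel ?_
    rw [coeff_taylor_succ, Derivation.leibniz, smul_eq_mul, smul_eq_mul, taylor_add, map_add, ih,
      ih, ← coeff_derivative, Derivation.leibniz, smul_eq_mul, smul_eq_mul, derivative_taylor,
      derivative_taylor, map_add]

lemma taylor_of_eq_zero {f : S'} (hf : D f = 0) : taylor D ϑ f = C (ϑ f) := by
  ext1 j
  cases j with
  | zero => simp [coeff_taylor_zero]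
  | succ j =>
    have h0 : D^[j] (0 : S') = 0 := by
      induction j with
      | zero => rfl
      | succ j ih => rw [Function.iterate_succ_apply, map_zero, ih]
    simp [taylor, hf, h0]

end Taylor

/-! ### Formal substitution of a series divisible by ε -/

section Substitution

open PowerSeries

variable {R : Type*} [CommRing R]

/-- The sum of a series `F` at a point `z` divisible by `ε`. -/
def substEps (z : PowerSeries R) (F : PowerSeries (PowerSeries R)) : PowerSeries R :=
  mk fun k => coeff k (∑ j ∈ Finset.range (k + 1), coeff j F * z ^ j)

variable {z : PowerSeries R}

lemma X_pow_dvd_eval (hz : X ∣ z) {K : ℕ} {p q : Polynomial (PowerSeries R)}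
    (h : ∀ j < K, p.coeff j = q.coeff j) : X ^ K ∣ p.eval z - q.eval z := by
  have h1 : Polynomial.X ^ K ∣ p - q := by
    rw [Polynomial.X_pow_dvd_iff]
    intro j hj
    rw [Polynomial.coeff_sub, h j hj, sub_self]
  obtain ⟨s, hs⟩ := h1
  rw [← Polynomial.eval_sub, hs, Polynomial.eval_mul, Polynomial.eval_pow, Polynomial.eval_X]
  exact Dvd.dvd.mul_right (pow_dvd_pow_of_dvd hz K) _

lemma eval_trunc_eq_sum (K : ℕ) (F : PowerSeries (PowerSeries R)) :
    (trunc K F).eval z = ∑ j ∈ Finset.range K, coeff j F * z ^ j :=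
  eval₂_trunc_eq_sum_range z (RingHom.id _) K F

/-- As ε divides `z`, the terms of degree at least K in `z` do not matter modulo ε^K. Identities for
`substEps` thus reduce to identities for polynomials, one power of ε at a time. -/
lemma X_pow_dvd_sub_substEps (hz : X ∣ z) {K : ℕ} {p : Polynomial (PowerSeries R)}
    {F : PowerSeries (PowerSeries R)} (h : ∀ j < K, p.coeff j = coeff j F) :
    X ^ K ∣ p.eval z - substEps z F := by
  rw [X_pow_dvd_iff]
  intro k hk
  have h1 : X ^ (k + 1) ∣ p.eval z - (trunc (k + 1) F).eval z :=
    X_pow_dvd_eval hz fun j hj => by rw [h j (by omega), coeff_trunc, if_pos hj]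
  rw [map_sub, substEps, coeff_mk, ← eval_trunc_eq_sum, ← map_sub]
  exact X_pow_dvd_iff.mp h1 k (by omega)

lemma X_pow_dvd_sum_sub_substEps (hz : X ∣ z) (K : ℕ) (F : PowerSeries (PowerSeries R)) :
    X ^ K ∣ ∑ j ∈ Finset.range K, coeff j F * z ^ j - substEps z F := by
  rw [← eval_trunc_eq_sum]
  exact X_pow_dvd_sub_substEps hz fun j hj => by rw [coeff_trunc, if_pos hj]

lemma eq_of_forall_X_pow_dvd {f g : PowerSeries R} (h : ∀ K, X ^ K ∣ f - g) : f = g := by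
  ext k
  have := X_pow_dvd_iff.mp (h (k + 1)) k (by omega)
  rwa [map_sub, sub_eq_zero] at this

lemma substEps_mul (hz : X ∣ z) (F G : PowerSeries (PowerSeries R)) :
    substEps z (F * G) = substEps z F * substEps z G := by
  refine eq_of_forall_X_pow_dvd fun K => ?_
  have h1 := X_pow_dvd_sub_substEps hz (F := F * G) (K := K) (p := trunc K F * trunc K G)
    fun j hj => by
      rw [coeff_mul_eq_coeff_trunc_mul_trunc F G hj, ← Polynomial.coe_mul, Polynomial.coeff_coe]
  have h2 := X_pow_dvd_sub_substEps hz (F := F) (K := K) (p := trunc K F)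
    fun j hj => by rw [coeff_trunc, if_pos hj]
  have h3 := X_pow_dvd_sub_substEps hz (F := G) (K := K) (p := trunc K G)
    fun j hj => by rw [coeff_trunc, if_pos hj]
  rw [Polynomial.eval_mul] at h1
  have h4 := (h2.mul_right ((trunc K G).eval z)).add (h3.mul_left (substEps z F))
  have := h4.sub h1
  convert this using 1
  ring

lemma substEps_add (F G : PowerSeries (PowerSeries R)) :
    substEps z (F + G) = substEps z F + substEps z G := by
  ext k
  simp [substEps, add_mul, Finset.sum_add_distrib]

lemma substEps_C (f : PowerSeries R) : substEps z (C f) = f := by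
  ext k
  rw [substEps, coeff_mk, Finset.sum_eq_single 0]
  · simp
  · intro j _ hj
    simp [coeff_C, hj]
  · simp

variable [Algebra ℝ R] {R' : Type*} [CommRing R'] [Algebra ℝ R']

lemma mapDer_substEps (hz : X ∣ z) (D : Derivation ℝ R R) (F : PowerSeries (PowerSeries R)) :
    mapDer D (substEps z F) =
      substEps z (mapDer (mapDer D) F) + mapDer D z * substEps z (derivative _ F) := by
  refine eq_of_forall_X_pow_dvd fun K => ?_
  -- One term more than the precision K is kept because differentiating the powers of `z` lowers the
  -- degree by one.
  obtain ⟨s, hs⟩ := X_pow_dvd_sum_sub_substEps hz (K + 1) F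
  have h1 : X ^ K ∣ mapDer D (∑ j ∈ Finset.range (K + 1), coeff j F * z ^ j) -
      mapDer D (substEps z F) := by
    rw [← map_sub, hs, Derivation.leibniz, Derivation.leibniz_pow, mapDer_X, smul_zero, smul_zero,
      smul_zero, add_zero, smul_eq_mul]
    exact Dvd.dvd.mul_right (pow_dvd_pow _ (Nat.le_succ K)) _
  have h2 := (pow_dvd_pow X (Nat.le_succ K)).trans
    (X_pow_dvd_sum_sub_substEps hz (K + 1) (mapDer (mapDer D) F))
  have h3 := (X_pow_dvd_sum_sub_substEps hz K (derivative _ F)).mul_left (mapDer D z)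
  have h4 : mapDer D (∑ j ∈ Finset.range (K + 1), coeff j F * z ^ j) =
      ∑ j ∈ Finset.range (K + 1), coeff j (mapDer (mapDer D) F) * z ^ j +
        mapDer D z * ∑ j ∈ Finset.range K, coeff j (derivative _ F) * z ^ j := by
    rw [map_sum]
    simp only [Derivation.leibniz, Derivation.leibniz_pow, smul_eq_mul, Finset.sum_add_distrib,
      coeff_mapDer]
    rw [add_comm]
    congr 1
    · exact Finset.sum_congr rfl fun j _ => mul_comm _ _
    · rw [Finset.sum_range_succ', Finset.mul_sum]
      simp only [zero_smul, mul_zero, add_zero]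
      refine Finset.sum_congr rfl fun j _ => ?_
      rw [coeff_derivative, nsmul_eq_mul, Nat.add_sub_cancel]
      push_cast
      ring
  rw [h4] at h1
  have := (h2.add h3).sub h1
  convert this using 1
  ring

variable (D' : Derivation ℝ R' R') (θ : R' →ₐ[ℝ] R)

@[simp] lemma coeff_mapAlgHom (f : PowerSeries R') (k : ℕ) :
    coeff k (mapAlgHom θ f) = θ (coeff k f) := by
  rw [mapAlgHom_apply, coeff_map]
  rfl

/-- The formal composition `f ↦ ∑ⱼ 1 / j! θ(D'ʲ f) zʲ`. -/
def compEps (hz : X ∣ z) : PowerSeries R' →ₐ[ℝ] PowerSeries R where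
  toFun f := substEps z (taylor (mapDer D') (mapAlgHom θ) f)
  map_one' := by
    rw [taylor_of_eq_zero _ _ (Derivation.map_one_eq_zero _), substEps_C, map_one]
  map_mul' f g := by rw [taylor_mul, substEps_mul hz]
  map_zero' := by rw [taylor_of_eq_zero _ _ (map_zero _), substEps_C, map_zero]
  map_add' f g := by rw [taylor_add, substEps_add]
  commutes' c := by
    rw [taylor_of_eq_zero _ _ (Derivation.map_algebraMap _ _), substEps_C, AlgHom.commutes]

variable (hz : X ∣ z)

lemma compEps_apply (f : PowerSeries R') :
    compEps D' θ hz f = substEps z (taylor (mapDer D') (mapAlgHom θ) f) := rfl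

lemma coeff_compEps (f : PowerSeries R') (k : ℕ) :
    coeff k (compEps D' θ hz f) = ∑ j ∈ Finset.range (k + 1),
      ∑ p ∈ Finset.HasAntidiagonal.antidiagonal k,
        ((1 / (j.factorial : ℝ)) • θ (D'^[j] (coeff p.1 f))) * coeff p.2 (z ^ j) := by
  have h (j p : ℕ) : coeff p ((mapDer D')^[j] f) = D'^[j] (coeff p f) := by
    induction j generalizing f with
    | zero => rfl
    | succ j ih => rw [Function.iterate_succ_apply, ih, coeff_mapDer, Function.iterate_succ_apply]
  simp [compEps_apply, substEps, taylor, coeff_mul, h, Finset.smul_sum]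

@[simp] lemma compEps_X : compEps D' θ hz X = X := by
  rw [compEps_apply, taylor_of_eq_zero _ _ (mapDer_X _), substEps_C, mapAlgHom_apply, map_X]

@[simp] lemma constantCoeff_compEps (f : PowerSeries R') :
    constantCoeff (compEps D' θ hz f) = θ (constantCoeff f) := by
  rw [← coeff_zero_eq_constantCoeff_apply, coeff_compEps]
  simp

/-- The chain rule for the formal composition. -/
lemma mapDer_compEps {E' : Derivation ℝ R' R'} {E : Derivation ℝ R R} {γ : R}
    (hcomm : ∀ f, E' (D' f) = D' (E' f)) (hchain : ∀ f, E (θ f) = θ (E' f) + γ * θ (D' f))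
    (f : PowerSeries R') :
    mapDer E (compEps D' θ hz f) = compEps D' θ hz (mapDer E' f) +
      (C γ + mapDer E z) * compEps D' θ hz (mapDer D' f) := by
  have hch (f : PowerSeries R') : mapDer E (mapAlgHom θ f) = mapAlgHom θ (mapDer E' f) +
      C γ * mapAlgHom θ (mapDer D' f) := by
    ext k
    simp [hchain]
  have hit (j : ℕ) : mapDer E' ((mapDer D')^[j] f) = (mapDer D')^[j] (mapDer E' f) := by
    induction j generalizing f with
    | zero => rfl
    | succ j ih => rw [Function.iterate_succ_apply, Function.iterate_succ_apply, ih,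
        mapDer_comm _ _ hcomm]
  have h : mapDer (mapDer E) (taylor (mapDer D') (mapAlgHom θ) f) =
      taylor (mapDer D') (mapAlgHom θ) (mapDer E' f) +
        C (C γ) * taylor (mapDer D') (mapAlgHom θ) (mapDer D' f) := by
    ext1 j
    rw [coeff_mapDer, map_add, coeff_C_mul]
    simp only [taylor, coeff_mk, Derivation.map_smul, hch, hit, mul_smul_comm, smul_add,
      ← Function.iterate_succ_apply, ← Function.iterate_succ_apply']
  simp only [compEps_apply]
  rw [mapDer_substEps hz, h, derivative_taylor, substEps_add, substEps_mul hz, substEps_C]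
  ring

/-- The leading coefficient of a series in the kernel is killed by the injective `θ`. Since ε is
mapped to ε, one factor ε can be cancelled and the argument repeated. -/
lemma compEps_injective (hθ : Function.Injective θ) : Function.Injective (compEps D' θ hz) := by
  rw [injective_iff_map_eq_zero]
  have key : ∀ k (f : PowerSeries R'), compEps D' θ hz f = 0 → coeff k f = 0 := by
    intro k
    induction k with
    | zero =>
      intro f hf
      have := congrArg constantCoeff hf
      rw [constantCoeff_compEps, map_zero, ← map_zero θ] at this
      simpa using hθ this
    | succ k ih =>
      intro f hf
      have h0 : constantCoeff f = 0 := by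
        have := congrArg constantCoeff hf
        rw [constantCoeff_compEps, map_zero, ← map_zero θ] at this
        exact hθ this
      have hX := eq_X_mul_shift_add_const f
      rw [h0, map_zero, add_zero] at hX
      rw [hX, map_mul, compEps_X] at hf
      have := ih _ (X_mul_cancel (hf.trans (mul_zero _).symm))
      simpa using this
  exact fun f hf => ext fun k => by rw [key k f hf, map_zero]

/-- Successive approximation: the leading coefficient of the target is matched through a right
inverse of `θ`, and `step` is the remaining error divided by ε. The preimage collects the leading
coefficients found at all steps. -/
lemma compEps_surjective (hθ : Function.Surjective θ) :
    Function.Surjective (compEps D' θ hz) := by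
  obtain ⟨ψ, hψ⟩ := hθ.hasRightInverse
  intro g
  set step : PowerSeries R → PowerSeries R := fun h =>
    mk fun p => coeff (p + 1) (h - compEps D' θ hz (C (ψ (constantCoeff h)))) with hstep
  have hstep' (h : PowerSeries R) : h = X * step h + compEps D' θ hz (C (ψ (constantCoeff h))) := by
    have := eq_X_mul_shift_add_const (h - compEps D' θ hz (C (ψ (constantCoeff h))))
    rw [map_sub, constantCoeff_compEps, constantCoeff_C, hψ, sub_self, map_zero, add_zero] at this
    rw [← sub_eq_iff_eq_add]
    exact this
  set s : ℕ → PowerSeries R' := fun n => mk fun j => ψ (constantCoeff (step^[j + n] g)) with hs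
  have hs' (n : ℕ) : s n = X * s (n + 1) + C (ψ (constantCoeff (step^[n] g))) := by
    have := eq_X_mul_shift_add_const (s n)
    convert this using 3
    · ext j
      simp only [hs, coeff_mk]
      rw [add_right_comm, add_assoc]
    · rw [← coeff_zero_eq_constantCoeff_apply (s n)]
      simp only [hs, coeff_mk, zero_add]
  have key (n : ℕ) : g - compEps D' θ hz (s 0) = X ^ n * (step^[n] g - compEps D' θ hz (s n)) := by
    induction n with
    | zero => simp
    | succ n ih =>
      rw [ih, hs' n, map_add, map_mul, compEps_X, Function.iterate_succ_apply']
      nth_rewrite 1 [hstep' (step^[n] g)]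
      ring
  exact ⟨s 0, (eq_of_forall_X_pow_dvd fun K => ⟨_, key K⟩).symm⟩

end Substitution

/-! ## Smooth functions of finitely many variables at a time -/

section Slices

variable {J : Set ℤ} {D : Set Pt} {f g : Pt → ℝ}

lemma update_updateFinset (t : Pt) {F : Finset ℤ} (u : F → ℝ) {n : ℤ} (hn : n ∈ F) (s : ℝ) :
    Function.update (Function.updateFinset t F u) n s =
      Function.updateFinset t F (Function.update u ⟨n, hn⟩ s) := by
  ext i
  by_cases hi : i = n
  · subst hi
    simp [Function.updateFinset, hn]
  · by_cases hiF : i ∈ F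
    · have : (⟨i, hiF⟩ : F) ≠ ⟨n, hn⟩ := fun h => hi (congrArg Subtype.val h)
      simp [Function.updateFinset, hi, hiF, this]
    · simp [Function.updateFinset, hi, hiF]

/-- The coordinates with index in `G` of a point of the slice with free variables `F`. -/
def sliceIncl (t : Pt) (F G : Finset ℤ) (u : F → ℝ) : G → ℝ :=
  fun i => Function.updateFinset t F u i

lemma updateFinset_sliceIncl (t : Pt) {F G : Finset ℤ} (h : F ⊆ G) (u : F → ℝ) :
    Function.updateFinset t G (sliceIncl t F G u) = Function.updateFinset t F u := by
  ext i
  by_cases hi : i ∈ G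
  · simp [Function.updateFinset, sliceIncl, hi]
  · have : i ∉ F := fun h' => hi (h h')
    simp [Function.updateFinset, hi, this]

lemma contDiff_sliceIncl (t : Pt) (F G : Finset ℤ) : ContDiff ℝ ∞ (sliceIncl t F G) := by
  rw [contDiff_pi]
  intro i
  by_cases hi : (i : ℤ) ∈ F
  · simpa [sliceIncl, Function.updateFinset, hi] using contDiff_apply ℝ ℝ (⟨i, hi⟩ : F)
  · simpa [sliceIncl, Function.updateFinset, hi] using contDiff_const

/-- A slice in fewer directions is an affine section of a slice in more directions, so only slices
containing prescribed directions need be examined. Below, the prescribed direction is often the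
space variable. -/
lemma finOpen_of_superset (F₀ : Finset ℤ) (hF₀ : (F₀ : Set ℤ) ⊆ J)
    (h : ∀ F : Finset ℤ, F₀ ⊆ F → (F : Set ℤ) ⊆ J → ∀ t : Pt,
      IsOpen {u : F → ℝ | Function.updateFinset t F u ∈ D}) : FinOpen J D := by
  intro F hF t
  have := (h (F ∪ F₀) Finset.subset_union_right (by simp [hF, hF₀]) t).preimage
    (contDiff_sliceIncl t F (F ∪ F₀)).continuous
  simpa [Set.preimage, updateFinset_sliceIncl t (Finset.subset_union_left : F ⊆ F ∪ F₀)] using this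

lemma smoothFun_of_superset (F₀ : Finset ℤ) (hF₀ : (F₀ : Set ℤ) ⊆ J)
    (h : ∀ F : Finset ℤ, F₀ ⊆ F → (F : Set ℤ) ⊆ J → ∀ t : Pt,
      ContDiffOn ℝ ∞ (fun u : F → ℝ => f (Function.updateFinset t F u))
        {u : F → ℝ | Function.updateFinset t F u ∈ D}) : SmoothFun J D f := by
  intro F hF t
  have := (h (F ∪ F₀) Finset.subset_union_right (by simp [hF, hF₀]) t).comp
    (contDiff_sliceIncl t F (F ∪ F₀)).contDiffOn
    (s := {u : F → ℝ | Function.updateFinset t F u ∈ D}) (by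
      intro u hu
      simpa [updateFinset_sliceIncl t (Finset.subset_union_left : F ⊆ F ∪ F₀)] using hu)
  simpa [Function.comp_def, updateFinset_sliceIncl t (Finset.subset_union_left : F ⊆ F ∪ F₀)]
    using this

lemma SmoothFun.congr (hf : SmoothFun J D f) (h : Set.EqOn f g D) : SmoothFun J D g :=
  fun F hF t => (hf F hF t).congr fun _ hu => (h hu).symm

lemma SmoothFun.add (hf : SmoothFun J D f) (hg : SmoothFun J D g) : SmoothFun J D (f + g) :=
  fun F hF t => (hf F hF t).add (hg F hF t)

lemma SmoothFun.mul (hf : SmoothFun J D f) (hg : SmoothFun J D g) : SmoothFun J D (f * g) :=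
  fun F hF t => (hf F hF t).mul (hg F hF t)

lemma smoothFun_const (c : ℝ) : SmoothFun J D (fun _ => c) :=
  fun _ _ _ => contDiffOn_const

lemma SmoothFun.contDiffAt (hD : FinOpen J D) (hf : SmoothFun J D f) {F : Finset ℤ}
    (hF : (F : Set ℤ) ⊆ J) {t : Pt} {u : F → ℝ} (hu : Function.updateFinset t F u ∈ D) :
    ContDiffAt ℝ ∞ (fun u : F → ℝ => f (Function.updateFinset t F u)) u :=
  (hf F hF t).contDiffAt ((hD F hF t).mem_nhds hu)

lemma SmoothFun.hasDerivAt_slice (hD : FinOpen J D) (hf : SmoothFun J D f) {F : Finset ℤ}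
    (hF : (F : Set ℤ) ⊆ J) {t : Pt} {u : F → ℝ} (hu : Function.updateFinset t F u ∈ D) {n : ℤ}
    (hn : n ∈ F) :
    HasDerivAt (fun s => f (Function.update (Function.updateFinset t F u) n s))
      (fderiv ℝ (fun u : F → ℝ => f (Function.updateFinset t F u)) u (Pi.single ⟨n, hn⟩ 1))
      (u ⟨n, hn⟩) := by
  simp only [update_updateFinset t u hn]
  have h1 := ((hf.contDiffAt hD hF hu).differentiableAt (by simp)).hasFDerivAt
  have h2 := hasDerivAt_update u (⟨n, hn⟩ : F) (u ⟨n, hn⟩)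
  rw [← Function.update_eq_self (⟨n, hn⟩ : F) u] at h1
  have h3 := h1.comp_hasDerivAt _ h2
  rw [Function.update_eq_self] at h3
  exact h3

lemma SmoothFun.pd_slice (hD : FinOpen J D) (hf : SmoothFun J D f) {F : Finset ℤ}
    (hF : (F : Set ℤ) ⊆ J) {t : Pt} {u : F → ℝ} (hu : Function.updateFinset t F u ∈ D) {n : ℤ}
    (hn : n ∈ F) :
    pd n f (Function.updateFinset t F u) =
      fderiv ℝ (fun u : F → ℝ => f (Function.updateFinset t F u)) u (Pi.single ⟨n, hn⟩ 1) := by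
  have h := (hf.hasDerivAt_slice hD hF hu hn).deriv
  rw [pd, ← h]
  simp [Function.updateFinset, hn]

lemma SmoothFun.hasDerivAt (hD : FinOpen J D) (hf : SmoothFun J D f) {n : ℤ} (hn : n ∈ J) {t : Pt}
    (ht : t ∈ D) : HasDerivAt (fun s => f (Function.update t n s)) (pd n f t) (t n) := by
  have hF : (({n} : Finset ℤ) : Set ℤ) ⊆ J := by simpa using hn
  have hu : Function.updateFinset t {n} (fun i => t i) ∈ D := by
    have : Function.updateFinset t {n} (fun i => t i) = t := Function.updateFinset_restrict t
    rwa [this]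
  have h := (hf.hasDerivAt_slice hD hF hu (Finset.mem_singleton_self n)).differentiableAt
  have h2 : Function.updateFinset t {n} (fun i => t i) = t := Function.updateFinset_restrict t
  rw [h2] at h
  exact h.hasDerivAt

lemma SmoothFun.pd (hD : FinOpen J D) (hf : SmoothFun J D f) {n : ℤ} (hn : n ∈ J) :
    SmoothFun J D (pd n f) := by
  refine smoothFun_of_superset {n} (by simpa using hn) fun F hnF hF t => ?_
  rw [Finset.singleton_subset_iff] at hnF
  have h := ((hf F hF t).fderiv_of_isOpen (m := ∞) (hD F hF t) (by simp)).clm_apply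
    (contDiffOn_const (c := (Pi.single ⟨n, hnF⟩ 1 : F → ℝ)))
  exact h.congr fun u hu => hf.pd_slice hD hF hu hnF

/-- The partial derivative at a point of `D` depends only on the values on `D`. -/
lemma pd_congr (hD : FinOpen J D) {n : ℤ} (hn : n ∈ J) (h : Set.EqOn f g D) :
    Set.EqOn (pd n f) (pd n g) D := by
  intro t ht
  have hF : (({n} : Finset ℤ) : Set ℤ) ⊆ J := by simpa using hn
  have ho := (hD {n} hF t).preimage (f := fun s : ℝ => fun _ : ({n} : Finset ℤ) => s) (by fun_prop)
  refine Filter.EventuallyEq.deriv_eq ?_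
  have hset : {s : ℝ | Function.update t n s ∈ D} ∈ nhds (t n) := by
    refine Filter.mem_of_superset (ho.mem_nhds ?_) ?_
    · simp only [Set.mem_preimage, Set.mem_ofPred_eq, Function.updateFinset_singleton]
      simpa using ht
    · intro s hs
      simpa [Function.updateFinset_singleton] using hs
  filter_upwards [hset] with s hs using h hs

/-- Symmetry of the second derivative on the slice spanned by the directions m and n. -/
lemma SmoothFun.pd_comm (hD : FinOpen J D) (hf : SmoothFun J D f) {m n : ℤ} (hm : m ∈ J)
    (hn : n ∈ J) : Set.EqOn (RKdVCH.pd m (RKdVCH.pd n f)) (RKdVCH.pd n (RKdVCH.pd m f)) D := by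
  intro t ht
  have hF : (({m, n} : Finset ℤ) : Set ℤ) ⊆ J := by
    intro i hi
    simp at hi
    rcases hi with rfl | rfl <;> assumption
  have ht' : Function.updateFinset t {m, n} (fun i => t i) = t := Function.updateFinset_restrict t
  have hmF : m ∈ ({m, n} : Finset ℤ) := by simp
  have hnF : n ∈ ({m, n} : Finset ℤ) := by simp
  set F : Finset ℤ := {m, n}
  set u : F → ℝ := fun i => t i
  have hu : Function.updateFinset t F u ∈ D := by rwa [ht']
  set φ : (F → ℝ) → ℝ := fun u => f (Function.updateFinset t F u) with hφ
  have hev {k : ℤ} (hk : k ∈ F) :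
      (fun u : F → ℝ => RKdVCH.pd k f (Function.updateFinset t F u)) =ᶠ[nhds u]
        fun u => fderiv ℝ φ u (Pi.single ⟨k, hk⟩ 1) := by
    filter_upwards [(hD F hF t).mem_nhds hu] with v hv using hf.pd_slice hD hF hv hk
  have hcd := hf.contDiffAt hD hF hu
  have hd2 : DifferentiableAt ℝ (fderiv ℝ φ) u :=
    (hcd.fderiv_right (m := 1) (by norm_cast)).differentiableAt (by simp)
  have key {k l : ℤ} (hk : k ∈ F) (hl : l ∈ F) : RKdVCH.pd l (RKdVCH.pd k f) t =
      fderiv ℝ (fderiv ℝ φ) u (Pi.single ⟨l, hl⟩ 1) (Pi.single ⟨k, hk⟩ 1) := by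
    rw [← ht', (hf.pd hD (hF hk)).pd_slice hD hF hu hl, (hev hk).fderiv_eq,
      fderiv_clm_apply hd2 (differentiableAt_const _)]
    simp
  rw [key hnF hmF, key hmF hnF]
  refine (hcd.isSymmSndFDerivAt ?_).eq _ _
  rw [minSmoothness_of_isRCLikeNormedField]
  exact WithTop.coe_le_coe.mpr le_top

end Slices

/-! ### The differential ring of smooth functions on the domain -/

section SmoothRing

/-- The extension by zero of a function on `D`. -/
def extendZero {D : Set Pt} (f : D → ℝ) : Pt → ℝ := Function.extend Subtype.val f 0

@[simp] lemma extendZero_apply {D : Set Pt} (f : D → ℝ) (t : D) : extendZero f t = f t :=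
  Subtype.val_injective.extend_apply f 0 t

lemma eqOn_extendZero {D : Set Pt} {f : Pt → ℝ} {g : D → ℝ} (h : ∀ t : D, g t = f t) :
    Set.EqOn (extendZero g) f D := fun t ht => (extendZero_apply g ⟨t, ht⟩).trans (h ⟨t, ht⟩)

/-- The subalgebra of smooth functions on `D`. -/
def smoothSubalgebra (J : Set ℤ) (D : Set Pt) : Subalgebra ℝ (D → ℝ) where
  carrier := {f | SmoothFun J D (extendZero f)}
  mul_mem' := fun {f g} hf hg =>
    (SmoothFun.mul hf hg).congr fun t ht => by
      have := eqOn_extendZero (g := f * g) (f := extendZero f * extendZero g) (by simp)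
      exact (this ht).symm
  add_mem' := fun {f g} hf hg =>
    (SmoothFun.add hf hg).congr fun t ht => by
      have := eqOn_extendZero (g := f + g) (f := extendZero f + extendZero g) (by simp)
      exact (this ht).symm
  algebraMap_mem' := fun c => (smoothFun_const c).congr fun t ht => by
      have := eqOn_extendZero (D := D) (g := algebraMap ℝ (D → ℝ) c) (f := fun _ => c) (by simp)
      exact (this ht).symm

/-- The ring of smooth functions on `D`. -/
def smoothRing (J : Set ℤ) (D : Set Pt) : Type := smoothSubalgebra J D

instance (J : Set ℤ) (D : Set Pt) : CommRing (smoothRing J D) :=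
  inferInstanceAs (CommRing (smoothSubalgebra J D))

instance (J : Set ℤ) (D : Set Pt) : Algebra ℝ (smoothRing J D) :=
  inferInstanceAs (Algebra ℝ (smoothSubalgebra J D))

/-- The inclusion into all functions on `D`. -/
def smoothRing.val (J : Set ℤ) (D : Set Pt) : smoothRing J D →ₐ[ℝ] (D → ℝ) :=
  (smoothSubalgebra J D).val

variable {J : Set ℤ} {D : Set Pt}

@[ext] lemma smoothRing.ext {f g : smoothRing J D} (h : ∀ t, f.1 t = g.1 t) : f = g :=
  Subtype.ext (funext h)

@[simp] lemma smoothRing.coe_add (f g : smoothRing J D) : (f + g).1 = f.1 + g.1 := rfl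

@[simp] lemma smoothRing.coe_mul (f g : smoothRing J D) : (f * g).1 = f.1 * g.1 := rfl

@[simp] lemma smoothRing.coe_smul (c : ℝ) (f : smoothRing J D) : (c • f).1 = c • f.1 := rfl

@[simp] lemma smoothRing.coe_zero : (0 : smoothRing J D).1 = 0 := rfl

@[simp] lemma smoothRing.coe_sum {ι : Type*} (s : Finset ι) (f : ι → smoothRing J D) :
    (∑ i ∈ s, f i).1 = ∑ i ∈ s, (f i).1 := map_sum (smoothRing.val J D) f s

/-- The restriction to `D` of a smooth function. -/
def SmoothFun.toRing {f : Pt → ℝ} (hf : SmoothFun J D f) : smoothRing J D :=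
  ⟨fun t => f t, hf.congr (eqOn_extendZero fun _ => rfl).symm⟩

@[simp] lemma SmoothFun.toRing_apply {f : Pt → ℝ} (hf : SmoothFun J D f) (t : D) :
    hf.toRing.1 t = f t := rfl

lemma smoothFun_extendZero (f : smoothRing J D) : SmoothFun J D (extendZero f.1) := f.2

/-- The partial derivative of smooth functions on `D`. -/
def der (hD : FinOpen J D) {n : ℤ} (hn : n ∈ J) :
    Derivation ℝ (smoothRing J D) (smoothRing J D) :=
  Derivation.mk'
    { toFun := fun f => ((smoothFun_extendZero f).pd hD hn).toRing
      map_add' := fun f g => by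
        ext t
        have h := (((smoothFun_extendZero f).hasDerivAt hD hn t.2).add ((smoothFun_extendZero g).hasDerivAt hD hn t.2)).deriv
        have := pd_congr hD hn (eqOn_extendZero (g := (f + g).1)
          (f := extendZero f.1 + extendZero g.1) (by simp)) t.2
        exact this.trans h
      map_smul' := fun c f => by
        ext t
        have h := (((smoothFun_extendZero f).hasDerivAt hD hn t.2).const_mul c).deriv
        have := pd_congr hD hn (eqOn_extendZero (g := (c • f).1)
          (f := fun t => c * extendZero f.1 t) (by simp)) t.2
        exact this.trans h }
    (fun f g => by
      ext t
      have h := (((smoothFun_extendZero f).hasDerivAt hD hn t.2).mul ((smoothFun_extendZero g).hasDerivAt hD hn t.2)).deriv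
      have := pd_congr hD hn (eqOn_extendZero (g := (f * g).1)
        (f := extendZero f.1 * extendZero g.1) (by simp)) t.2
      refine (this.trans h).trans ?_
      simp only [Function.update_eq_self, extendZero_apply]
      change _ = f.1 t * pd n (extendZero g.1) t + g.1 t * pd n (extendZero f.1) t
      ring)

lemma der_apply (hD : FinOpen J D) {n : ℤ} (hn : n ∈ J) (f : smoothRing J D) (t : D) :
    (der hD hn f).1 t = pd n (extendZero f.1) t := rfl

lemma der_comm (hD : FinOpen J D) {m n : ℤ} (hm : m ∈ J) (hn : n ∈ J) (f : smoothRing J D) :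
    der hD hm (der hD hn f) = der hD hn (der hD hm f) := by
  ext t
  rw [der_apply, der_apply]
  have h1 (k : ℤ) (hk : k ∈ J) : Set.EqOn (extendZero (der hD hk f).1) (pd k (extendZero f.1)) D :=
    eqOn_extendZero fun t => der_apply hD hk f t
  rw [pd_congr hD hm (h1 n hn) t.2, pd_congr hD hn (h1 m hm) t.2]
  exact (smoothFun_extendZero f).pd_comm hD hm hn t.2

/-! ### Restriction of fields to `D` -/

/-- The restriction of fields to `D`. -/
def restr (D : Set Pt) : Fld →ₐ[ℝ] PowerSeries (D → ℝ) :=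
  PowerSeries.mapAlgHom (AlgHom.pi fun t : D => Pi.evalAlgHom ℝ (fun _ : Pt => ℝ) t)

/-- The inclusion of series with smooth coefficients. -/
def incl (J : Set ℤ) (D : Set Pt) : PowerSeries (smoothRing J D) →ₐ[ℝ] PowerSeries (D → ℝ) :=
  PowerSeries.mapAlgHom (smoothRing.val J D)

@[simp] lemma coeff_restr (f : Fld) (k : ℕ) (t : D) :
    PowerSeries.coeff k (restr D f) t = PowerSeries.coeff k f t := by
  rw [restr, coeff_mapAlgHom]; rfl

@[simp] lemma coeff_incl (F : PowerSeries (smoothRing J D)) (k : ℕ) :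
    PowerSeries.coeff k (incl J D F) = (PowerSeries.coeff k F).1 := by
  rw [incl, coeff_mapAlgHom]; rfl

lemma incl_injective : Function.Injective (incl J D) := fun F G h => by
  ext k t
  have := congrFun (congrArg (PowerSeries.coeff k) h) t
  simpa using this

/-- The field `f` restricts on `D` to the series `F` with smooth coefficients. -/
def Rep (f : Fld) (F : PowerSeries (smoothRing J D)) : Prop := restr D f = incl J D F

lemma rep_iff {f : Fld} {F : PowerSeries (smoothRing J D)} : Rep f F ↔
    ∀ k (t : D), PowerSeries.coeff k f t = (PowerSeries.coeff k F).1 t := by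
  constructor
  · intro h k t
    rw [← coeff_restr, h, coeff_incl]
  · intro h
    refine PowerSeries.ext fun k => funext fun t => ?_
    rw [coeff_restr, h, coeff_incl]

variable {f g : Fld} {F G : PowerSeries (smoothRing J D)}

lemma Rep.add (hf : Rep f F) (hg : Rep g G) : Rep (f + g) (F + G) := by
  rw [Rep, map_add, map_add, hf, hg]

lemma Rep.sub (hf : Rep f F) (hg : Rep g G) : Rep (f - g) (F - G) := by
  rw [Rep, map_sub, map_sub, hf, hg]

lemma Rep.mul (hf : Rep f F) (hg : Rep g G) : Rep (f * g) (F * G) := by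
  rw [Rep, map_mul, map_mul, hf, hg]

lemma Rep.pow (hf : Rep f F) (n : ℕ) : Rep (f ^ n) (F ^ n) := by
  rw [Rep, map_pow, map_pow, hf]

lemma Rep.neg (hf : Rep f F) : Rep (-f) (-F) := by
  rw [Rep, map_neg, map_neg, hf]

lemma Rep.smul (c : ℝ) (hf : Rep f F) : Rep (c • f) (c • F) := by
  rw [Rep, map_smul, map_smul, hf]

lemma rep_zero : Rep 0 (0 : PowerSeries (smoothRing J D)) := by
  rw [Rep, map_zero, map_zero]

lemma rep_one : Rep 1 (1 : PowerSeries (smoothRing J D)) := by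
  rw [Rep, map_one, map_one]

lemma rep_two : Rep 2 (2 : PowerSeries (smoothRing J D)) := by
  rw [Rep, map_ofNat, map_ofNat]

lemma rep_eps : Rep eps (PowerSeries.X : PowerSeries (smoothRing J D)) := by
  rw [Rep, restr, incl, eps, PowerSeries.mapAlgHom_apply, PowerSeries.mapAlgHom_apply,
    PowerSeries.map_X, PowerSeries.map_X]

lemma rep_sum {ι : Type*} {s : Finset ι} {f : ι → Fld} {F : ι → PowerSeries (smoothRing J D)}
    (h : ∀ i ∈ s, Rep (f i) (F i)) : Rep (∑ i ∈ s, f i) (∑ i ∈ s, F i) := by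
  rw [Rep, map_sum, map_sum]
  exact Finset.sum_congr rfl h

lemma Rep.d (hD : FinOpen J D) {n : ℤ} (hn : n ∈ J) (hf : Rep f F) :
    Rep (d n f) (mapDer (der hD hn) F) := by
  rw [rep_iff] at hf ⊢
  intro k t
  rw [RKdVCH.d, PowerSeries.coeff_mk, coeff_mapDer, der_apply]
  exact (pd_congr hD hn (eqOn_extendZero fun t => (hf k t).symm) t.2).symm

/-- The bridge between analysis and algebra: agreement on the domain becomes equality in a
commutative ring with commuting derivations, where the abstract hierarchy lives. -/
lemma Rep.agree_iff (hf : Rep f F) (hg : Rep g G) : Agree D f g ↔ F = G := by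
  rw [rep_iff] at hf hg
  constructor
  · intro h
    ext k t
    rw [← hf, ← hg]
    exact h k t.2
  · rintro rfl k t ht
    exact (hf k ⟨t, ht⟩).trans (hg k ⟨t, ht⟩).symm

lemma Rep.smooth (hf : Rep f F) : Smooth J D f := by
  rw [rep_iff] at hf
  exact fun k => (smoothFun_extendZero (PowerSeries.coeff k F)).congr (eqOn_extendZero fun t => (hf k t).symm)

lemma Smooth.exists_rep (hf : Smooth J D f) : ∃ F : PowerSeries (smoothRing J D), Rep f F :=
  ⟨PowerSeries.mk fun k => (hf k).toRing, rep_iff.mpr fun k t => by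
    rw [PowerSeries.coeff_mk]; rfl⟩

lemma exists_rep (F : PowerSeries (smoothRing J D)) : ∃ f : Fld, Rep f F :=
  ⟨PowerSeries.mk fun k => extendZero (PowerSeries.coeff k F).1, rep_iff.mpr fun k t => by
    rw [PowerSeries.coeff_mk, extendZero_apply]⟩

lemma Rep.recip (hf : Rep f F) (h : G * F = 1) : Rep (recip f) G := by
  rw [rep_iff]
  intro k t
  rw [RKdVCH.recip, PowerSeries.coeff_mk]
  set ev : smoothRing J D →+* ℝ := (Pi.evalRingHom (fun _ : D => ℝ) t).comp
    (smoothRing.val J D).toRingHom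
  have h1 : PowerSeries.map (Pi.evalRingHom (fun _ : Pt => ℝ) t) f = PowerSeries.map ev F := by
    ext k
    rw [PowerSeries.coeff_map, PowerSeries.coeff_map]
    exact rep_iff.mp hf k t
  have h2 : PowerSeries.map ev G * PowerSeries.map ev F = 1 := by rw [← map_mul, h, map_one]
  have h3 : PowerSeries.constantCoeff (PowerSeries.map ev F) ≠ 0 := fun h0 => by
    have := congrArg PowerSeries.constantCoeff h2
    rw [map_mul, h0, mul_zero, map_one] at this
    exact zero_ne_one this
  have h4 : (PowerSeries.map ev F)⁻¹ = PowerSeries.map ev G :=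
    ((PowerSeries.eq_inv_iff_mul_eq_one h3).mpr h2).symm
  rw [h1, h4, PowerSeries.coeff_map]
  rfl

/-! ### Restriction of generating series -/

/-- Coefficientwise restriction of generating series. -/
def GenRep (f : Gen) (F : PowerSeries (PowerSeries (smoothRing J D))) : Prop :=
  ∀ j, Rep (PowerSeries.coeff j f) (PowerSeries.coeff j F)

variable {f g : Gen} {F G : PowerSeries (PowerSeries (smoothRing J D))}

lemma GenRep.sub (hf : GenRep f F) (hg : GenRep g G) : GenRep (f - g) (F - G) := fun j => by
  rw [map_sub, map_sub]; exact (hf j).sub (hg j)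

lemma GenRep.mul (hf : GenRep f F) (hg : GenRep g G) : GenRep (f * g) (F * G) := fun j => by
  rw [PowerSeries.coeff_mul, PowerSeries.coeff_mul]
  exact rep_sum fun p _ => (hf p.1).mul (hg p.2)

lemma GenRep.sq (hf : GenRep f F) : GenRep (f ^ 2) (F ^ 2) := by
  rw [pow_two, pow_two]; exact hf.mul hf

lemma genRep_C {f : Fld} {F : PowerSeries (smoothRing J D)} (hf : Rep f F) :
    GenRep (PowerSeries.C f) (PowerSeries.C F) := fun j => by
  rw [PowerSeries.coeff_C, PowerSeries.coeff_C]
  split_ifs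
  · exact hf
  · exact rep_zero

lemma genRep_mk {f : ℕ → Fld} {F : ℕ → PowerSeries (smoothRing J D)} (hf : ∀ j, Rep (f j) (F j)) :
    GenRep (PowerSeries.mk f) (PowerSeries.mk F) := fun j => by
  rw [PowerSeries.coeff_mk, PowerSeries.coeff_mk]; exact hf j

lemma GenRep.dx (hD : FinOpen J D) (h0 : (0 : ℤ) ∈ J) (hf : GenRep f F) :
    GenRep (dx f) (mapDer (mapDer (der hD h0)) F) := fun j => by
  rw [RKdVCH.dx, PowerSeries.coeff_mk, coeff_mapDer]; exact (hf j).d hD h0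

lemma GenRep.quad (hD : FinOpen J D) (h0 : (0 : ℤ) ∈ J) {p q : Gen}
    {P Q : PowerSeries (PowerSeries (smoothRing J D))} (hp : GenRep p P) (hq : GenRep q Q)
    (hf : GenRep f F) :
    GenRep (quad p q f) (quadD (mapDer (mapDer (der hD h0))) (quarterEpsSq _) P Q F) := by
  have h2 : GenRep (2 : Gen) (2 : PowerSeries (PowerSeries (smoothRing J D))) := by
    have := genRep_C (rep_two (J := J) (D := D))
    rwa [map_ofNat, map_ofNat] at this
  exact (hp.mul hf.sq).sub (((genRep_C ((rep_eps.pow 2).smul _)).mul hq).mul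
    (((h2.mul hf).mul ((hf.dx hD h0).dx hD h0)).sub (hf.dx hD h0).sq))

lemma GenRep.agree_iff (hf : GenRep f F) (hg : GenRep g G) : GenAgree D f g ↔ F = G := by
  rw [GenAgree, PowerSeries.ext_iff]
  exact forall_congr' fun j => (hf j).agree_iff (hg j)

lemma genRep_one : GenRep 1 (1 : PowerSeries (PowerSeries (smoothRing J D))) := by
  have := genRep_C (rep_one (J := J) (D := D))
  rwa [map_one, map_one] at this

lemma exists_genRep_of_smooth (hf : ∀ j, Smooth J D (PowerSeries.coeff j f)) :
    ∃ F : PowerSeries (PowerSeries (smoothRing J D)), GenRep f F := by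
  choose F hF using fun j => (hf j).exists_rep
  exact ⟨PowerSeries.mk F, fun j => by rw [PowerSeries.coeff_mk]; exact hF j⟩

lemma exists_genRep (F : PowerSeries (PowerSeries (smoothRing J D))) : ∃ f : Gen, GenRep f F := by
  choose f hf using fun j => exists_rep (PowerSeries.coeff j F)
  exact ⟨PowerSeries.mk f, fun j => by rw [PowerSeries.coeff_mk]; exact hf j⟩

lemma Rep.dop (hD : FinOpen J D) (h0 : (0 : ℤ) ∈ J) {r : ℕ} (a : Fin (r + 1) → ℝ)
    (w : Fin r → Fld) (i : ℤ) {W : PowerSeries (smoothRing J D)} (hw : Rep (wc w i) W) {f : Fld}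
    {F : PowerSeries (smoothRing J D)} (hf : Rep f F) :
    Rep (Dop a w i f) (dopD (der hD h0) (ac a i) W F) :=
  (((rep_two.mul hw).mul (hf.d hD h0)).add ((hw.d hD h0).mul hf)).sub
    (((rep_eps.pow 2).mul (((hf.d hD h0).d hD h0).d hD h0)).smul _)

lemma GenRep.bc {b c : Gen} {B C : PowerSeries (PowerSeries (smoothRing J D))} (hb : GenRep b B)
    (hc : GenRep c C) (n m : ℤ) : Rep (Bc b c n m) (bcD B C n m) := by
  unfold Bc bcD
  split_ifs
  · exact hb _
  · exact rep_zero
  · exact hc _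
  · exact rep_zero

lemma GenRep.alpha {b c : Gen} {B C : PowerSeries (PowerSeries (smoothRing J D))}
    (hb : GenRep b B) (hc : GenRep c C) (hb0 : PowerSeries.coeff 0 B = 1)
    {U : PowerSeries (smoothRing J D)} (hU : U * PowerSeries.coeff 0 C = 1) (n : ℤ) :
    Rep (alpha b c n) (U * betaD B C n) := by
  refine ((hc 0).recip hU).mul ?_
  unfold betaD
  split_ifs with h1 h2 h3 h4
  · subst h1
    rw [Int.toNat_zero, hb0]
    exact rep_one
  · omega
  · exact hb _
  · omega
  · omega
  · exact (hc _).neg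

end SmoothRing

/-! ## The change of variables at leading order -/

section InverseFunction

variable {E E' : Type*} [NormedAddCommGroup E] [NormedSpace ℝ E] [CompleteSpace E]
  [NormedAddCommGroup E'] [NormedSpace ℝ E']

lemma isOpen_image_of_hasFDerivAt_equiv {φ : E → E'} {U : Set E} (hU : IsOpen U)
    (hφ : ContDiffOn ℝ ∞ φ U) (he : ∀ u ∈ U, ∃ e : E ≃L[ℝ] E', HasFDerivAt φ (e : E →L[ℝ] E') u) :
    IsOpen (φ '' U) := by
  rw [isOpen_iff_mem_nhds]
  rintro _ ⟨u, hu, rfl⟩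
  obtain ⟨e, he⟩ := he u hu
  have hs := (hφ.contDiffAt (hU.mem_nhds hu)).hasStrictFDerivAt' he (by simp)
  rw [← hs.map_nhds_eq_of_equiv]
  exact Filter.image_mem_map (hU.mem_nhds hu)

/-- Near φ(u) the local inverse from the inverse function theorem takes values in `U`, where the
left inverse `ψ` must coincide with it. -/
lemma contDiffOn_leftInverse {φ : E → E'} {ψ : E' → E} {U : Set E} (hU : IsOpen U)
    (hφ : ContDiffOn ℝ ∞ φ U) (he : ∀ u ∈ U, ∃ e : E ≃L[ℝ] E', HasFDerivAt φ (e : E →L[ℝ] E') u)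
    (hψ : ∀ u ∈ U, ψ (φ u) = u) : ContDiffOn ℝ ∞ ψ (φ '' U) := by
  rintro _ ⟨u, hu, rfl⟩
  obtain ⟨e, he⟩ := he u hu
  have hcd := hφ.contDiffAt (hU.mem_nhds hu)
  have hs := hcd.hasStrictFDerivAt' he (by simp)
  refine ContDiffAt.contDiffWithinAt ?_
  refine (hcd.to_localInverse he (by simp)).congr_of_eventuallyEq ?_
  have h1 := hs.eventually_right_inverse
  have h2 : ∀ᶠ v in nhds (φ u), hs.localInverse φ e u v ∈ U := by
    refine hs.localInverse_continuousAt.eventually ?_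
    rw [hs.localInverse_apply_image]
    exact hU.mem_nhds hu
  filter_upwards [h1, h2] with v hv1 hv2
  have := hψ _ hv2
  rw [hv1] at this
  exact this

end InverseFunction

/-! ### The map from old to new independent variables and its pull-back -/

section Reciprocal

variable {J : Set ℤ} {D : Set Pt} {y : Fld}

/-- The assumptions on the leading part of `y` under which the map `newPoint y` is a change of
variables on `D`. -/
structure IsChange (J : Set ℤ) (D : Set Pt) (y : Fld) : Prop where
  zero_mem : (0 : ℤ) ∈ J
  finOpen : FinOpen J D
  ordConnected : ∀ t : Pt, Set.OrdConnected {x : ℝ | Function.update t 0 x ∈ D}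
  smooth : SmoothFun J D (PowerSeries.coeff 0 y)
  pos : ∀ t ∈ D, 0 < pd 0 (PowerSeries.coeff 0 y) t

lemma newPoint_of_ne (y : Fld) (t : Pt) {n : ℤ} (hn : n ≠ 0) : newPoint y t n = t (-n) := if_neg hn

@[simp] lemma newPoint_zero (y : Fld) (t : Pt) : newPoint y t 0 = PowerSeries.coeff 0 y t :=
  if_pos rfl

/-- Points with the same image share all times, hence lie on one line parallel to the x-axis. There
the domain is an interval on which the leading part of `y` is strictly increasing. -/
lemma IsChange.injOn (h : IsChange J D y) : Set.InjOn (newPoint y) D := by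
  intro t ht t' ht' htt'
  have ht'eq : t' = Function.update t 0 (t' 0) := by
    ext n
    by_cases hn : n = 0
    · subst hn; simp
    · have := congrFun htt' (-n)
      rw [newPoint_of_ne y t (neg_ne_zero.mpr hn), newPoint_of_ne y t' (neg_ne_zero.mpr hn),
        neg_neg] at this
      simp [hn, this]
  set S : Set ℝ := {x : ℝ | Function.update t 0 x ∈ D}
  have hder : ∀ x ∈ S, HasDerivAt (fun x => PowerSeries.coeff 0 y (Function.update t 0 x))
      (pd 0 (PowerSeries.coeff 0 y) (Function.update t 0 x)) x := by
    intro x hx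
    have := h.smooth.hasDerivAt h.finOpen h.zero_mem hx
    simpa using this
  have hmono : StrictMonoOn (fun x => PowerSeries.coeff 0 y (Function.update t 0 x)) S := by
    refine strictMonoOn_of_deriv_pos (h.ordConnected t).convex
      (fun x hx => (hder x hx).continuousAt.continuousWithinAt) fun x hx => ?_
    rw [(hder x (interior_subset hx)).deriv]
    exact h.pos _ (show x ∈ S from interior_subset hx)
  have h0 := congrFun htt' 0
  rw [newPoint_zero, newPoint_zero, ht'eq] at h0
  have htS : t 0 ∈ S := by simpa [S] using ht
  have ht'S : t' 0 ∈ S := by rw [ht'eq] at ht'; exact ht'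
  have := hmono.injOn htS ht'S (by simpa using h0)
  rw [ht'eq, ← this, Function.update_eq_self]

/-- The negatives of the indices in `G`. -/
def negIdx (G : Finset ℤ) : Finset ℤ := G.image fun n => -n

@[simp] lemma mem_negIdx {G : Finset ℤ} {n : ℤ} : n ∈ negIdx G ↔ -n ∈ G := by
  constructor
  · intro h
    obtain ⟨m, hm, rfl⟩ := Finset.mem_image.mp h
    rwa [neg_neg]
  · intro h
    exact Finset.mem_image.mpr ⟨-n, h, neg_neg n⟩

lemma negIdx_negIdx (G : Finset ℤ) : negIdx (negIdx G) = G := by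
  ext n; simp

lemma card_negIdx (G : Finset ℤ) : (negIdx G).card = G.card :=
  Finset.card_image_of_injective _ neg_injective

/-- The point with the indices of the coordinates negated. -/
def negPt (t : Pt) : Pt := fun n => t (-n)

/-- The change of variables between slices. -/
def sliceMap (y : Fld) (t : Pt) (G : Finset ℤ) (u : G → ℝ) : negIdx G → ℝ :=
  fun i => newPoint y (Function.updateFinset t G u) i

lemma updateFinset_sliceMap {G : Finset ℤ} (hG : (0 : ℤ) ∈ G) (t : Pt) (u : G → ℝ) :
    Function.updateFinset (negPt t) (negIdx G) (sliceMap y t G u) =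
      newPoint y (Function.updateFinset t G u) := by
  ext i
  by_cases hi : i ∈ negIdx G
  · simp only [Function.updateFinset, hi, dif_pos]
    rfl
  · have hi' : -i ∉ G := by simpa using hi
    have h0 : i ≠ 0 := by
      rintro rfl
      exact hi' (by simpa using hG)
    simp [Function.updateFinset, hi', newPoint_of_ne y _ h0, negPt]

/-- The derivative of the change of variables between slices. -/
def sliceDeriv (y : Fld) (t : Pt) (G : Finset ℤ) (u : G → ℝ) : (G → ℝ) →L[ℝ] (negIdx G → ℝ) :=
  ContinuousLinearMap.pi fun i =>
    if (i : ℤ) = 0 then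
      fderiv ℝ (fun u : G → ℝ => PowerSeries.coeff 0 y (Function.updateFinset t G u)) u
    else ContinuousLinearMap.proj (⟨-i, mem_negIdx.mp i.2⟩ : G)

lemma sliceMap_apply (t : Pt) (G : Finset ℤ) (u : G → ℝ) (i : negIdx G) :
    sliceMap y t G u i = if (i : ℤ) = 0 then PowerSeries.coeff 0 y (Function.updateFinset t G u)
      else u ⟨-i, mem_negIdx.mp i.2⟩ := by
  have := mem_negIdx.mp i.2
  by_cases hi : (i : ℤ) = 0
  · simp [sliceMap, hi]
  · simp [sliceMap, hi, newPoint_of_ne y _ hi, Function.updateFinset, this]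

lemma IsChange.contDiffOn_sliceMap (h : IsChange J D y) (t : Pt) {G : Finset ℤ}
    (hG : (G : Set ℤ) ⊆ J) :
    ContDiffOn ℝ ∞ (sliceMap y t G) {u : G → ℝ | Function.updateFinset t G u ∈ D} := by
  rw [contDiffOn_pi]
  intro i
  simp only [sliceMap_apply]
  split_ifs
  · exact h.smooth G hG t
  · exact (contDiff_apply ℝ ℝ (⟨-i, mem_negIdx.mp i.2⟩ : G)).contDiffOn

lemma IsChange.hasFDerivAt_sliceMap (h : IsChange J D y) {t : Pt} {G : Finset ℤ}
    (hG : (G : Set ℤ) ⊆ J) {u : G → ℝ} (hu : Function.updateFinset t G u ∈ D) :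
    HasFDerivAt (sliceMap y t G) (sliceDeriv y t G u) u := by
  rw [sliceDeriv, hasFDerivAt_pi]
  intro i
  simp only [sliceMap_apply]
  split_ifs
  · exact ((h.smooth.contDiffAt h.finOpen hG hu).differentiableAt (by simp)).hasFDerivAt
  · exact hasFDerivAt_apply _ _

/-- The derivative is triangular: a kernel vector has no time components, and its x-component is
multiplied by the positive number ∂ₓ y₀. -/
lemma IsChange.sliceDeriv_injective (h : IsChange J D y) {t : Pt} {G : Finset ℤ}
    (hG : (G : Set ℤ) ⊆ J) (hG0 : (0 : ℤ) ∈ G) {u : G → ℝ}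
    (hu : Function.updateFinset t G u ∈ D) : Function.Injective (sliceDeriv y t G u) := by
  rw [injective_iff_map_eq_zero]
  intro v hv
  have hne (i : G) (hi : (i : ℤ) ≠ 0) : v i = 0 := by
    have := congrFun hv (⟨-i, by simp⟩ : negIdx G)
    simpa [sliceDeriv, hi] using this
  have hv' : v = v ⟨0, hG0⟩ • (Pi.single ⟨0, hG0⟩ 1 : G → ℝ) := by
    ext i
    by_cases hi : i = ⟨0, hG0⟩
    · subst hi; simp
    · have : (i : ℤ) ≠ 0 := fun h' => hi (Subtype.ext h')
      simp [hne i this, hi]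
  have h0 := congrFun hv (⟨0, by simpa using hG0⟩ : negIdx G)
  simp only [sliceDeriv, ContinuousLinearMap.coe_pi', if_true, Pi.zero_apply] at h0
  rw [hv', map_smul, ← h.smooth.pd_slice h.finOpen hG hu hG0, smul_eq_mul] at h0
  have := (mul_eq_zero.mp h0).resolve_right (h.pos _ hu).ne'
  rw [hv', this, zero_smul]

lemma IsChange.exists_equiv (h : IsChange J D y) {t : Pt} {G : Finset ℤ}
    (hG : (G : Set ℤ) ⊆ J) (hG0 : (0 : ℤ) ∈ G) {u : G → ℝ}
    (hu : Function.updateFinset t G u ∈ D) :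
    ∃ e : (G → ℝ) ≃L[ℝ] (negIdx G → ℝ), HasFDerivAt (sliceMap y t G)
      (e : (G → ℝ) →L[ℝ] (negIdx G → ℝ)) u := by
  refine ⟨(LinearMap.linearEquivOfInjective (sliceDeriv y t G u : (G → ℝ) →ₗ[ℝ] _)
    (h.sliceDeriv_injective hG hG0 hu) (by simp [card_negIdx])).toContinuousLinearEquiv, ?_⟩
  exact h.hasFDerivAt_sliceMap hG hu

/-- A frozen coordinate of the new point determines the corresponding old one only if it is a time.
With 0 in `G` all frozen variables are times, so every preimage lies in the slice through `t`. -/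
lemma setOf_mem_image_newPoint {G : Finset ℤ} (hG0 : (0 : ℤ) ∈ G) (t : Pt) :
    {v : negIdx G → ℝ | Function.updateFinset (negPt t) (negIdx G) v ∈ newPoint y '' D} =
      sliceMap y t G '' {u : G → ℝ | Function.updateFinset t G u ∈ D} := by
  ext v
  constructor
  · rintro ⟨s, hs, hsv⟩
    have hs' : Function.updateFinset t G (fun i => s i) = s := by
      ext n
      by_cases hn : n ∈ G
      · simp [Function.updateFinset, hn]
      · have h0 : n ≠ 0 := fun h0 => hn (h0 ▸ hG0)
        have := congrFun hsv (-n)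
        rw [newPoint_of_ne y s (neg_ne_zero.mpr h0), neg_neg] at this
        simp [Function.updateFinset, hn, this, negPt]
    refine ⟨fun i => s i, ?_, ?_⟩
    · simpa [hs'] using hs
    · ext i
      rw [sliceMap, hs', hsv]
      simp only [Function.updateFinset, i.2, dif_pos]
  · rintro ⟨u, hu, rfl⟩
    exact ⟨_, hu, (updateFinset_sliceMap hG0 t u).symm⟩

lemma zero_mem_negTimes (h0 : (0 : ℤ) ∈ J) : (0 : ℤ) ∈ negTimes J := by
  simpa [negTimes] using h0

lemma negIdx_subset {F : Finset ℤ} (hF : (F : Set ℤ) ⊆ negTimes J) :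
    (negIdx F : Set ℤ) ⊆ J := by
  intro n hn
  have : -n ∈ F := by simpa using hn
  simpa [negTimes] using hF this

lemma negIdx_subset' {F : Finset ℤ} (hF : (F : Set ℤ) ⊆ J) :
    (negIdx F : Set ℤ) ⊆ negTimes J := by
  intro n hn
  have : -n ∈ F := by simpa using hn
  exact hF this

lemma negPt_negPt (t : Pt) : negPt (negPt t) = t := by
  ext n; simp [negPt]

lemma IsChange.finOpen_image (h : IsChange J D y) : FinOpen (negTimes J) (newPoint y '' D) := by
  refine finOpen_of_superset {0} (by simpa using zero_mem_negTimes h.zero_mem) fun F h0F hF t => ?_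
  obtain ⟨G, rfl⟩ : ∃ G, F = negIdx G := ⟨negIdx F, (negIdx_negIdx F).symm⟩
  have hG0 : (0 : ℤ) ∈ G := by simpa using h0F
  have hG : (G : Set ℤ) ⊆ J := by simpa [negIdx_negIdx] using negIdx_subset hF
  rw [← negPt_negPt t, setOf_mem_image_newPoint hG0]
  exact isOpen_image_of_hasFDerivAt_equiv (h.finOpen G hG _) (h.contDiffOn_sliceMap _ hG)
    fun u hu => h.exists_equiv hG hG0 hu

lemma IsChange.smooth_comp (h : IsChange J D y) {f : Pt → ℝ}
    (hf : SmoothFun (negTimes J) (newPoint y '' D) f) :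
    SmoothFun J D (fun t => f (newPoint y t)) := by
  refine smoothFun_of_superset {0} (by simpa using h.zero_mem) fun G h0G hG t => ?_
  have hG0 : (0 : ℤ) ∈ G := by simpa using h0G
  have := (hf (negIdx G) (negIdx_subset' hG) (negPt t)).comp (h.contDiffOn_sliceMap t hG)
    (by
      rw [setOf_mem_image_newPoint hG0]
      exact Set.mapsTo_image _ _)
  refine this.congr fun u _ => ?_
  simp only [Function.comp_apply, updateFinset_sliceMap hG0]

/-- On each slice containing the space variable, `f` is the given smooth composite preceded by the
inverse of the slice map, which is smooth by `contDiffOn_leftInverse`. -/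
lemma IsChange.smooth_of_comp (h : IsChange J D y) {f : Pt → ℝ}
    (hf : SmoothFun J D (fun t => f (newPoint y t))) :
    SmoothFun (negTimes J) (newPoint y '' D) f := by
  refine smoothFun_of_superset {0} (by simpa using zero_mem_negTimes h.zero_mem)
    fun F h0F hF t => ?_
  obtain ⟨G, rfl⟩ : ∃ G, F = negIdx G := ⟨negIdx F, (negIdx_negIdx F).symm⟩
  have hG0 : (0 : ℤ) ∈ G := by simpa using h0F
  have hG : (G : Set ℤ) ⊆ J := by simpa [negIdx_negIdx] using negIdx_subset hF
  obtain ⟨t, rfl⟩ : ∃ s, t = negPt s := ⟨negPt t, (negPt_negPt t).symm⟩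
  rw [setOf_mem_image_newPoint hG0]
  set U := {u : G → ℝ | Function.updateFinset t G u ∈ D} with hU
  have hinj : Set.InjOn (sliceMap y t G) U := by
    intro u hu v hv huv
    have := h.injOn hu hv (by rw [← updateFinset_sliceMap hG0, huv, updateFinset_sliceMap hG0])
    ext i
    simpa [Function.updateFinset] using congrFun this i
  have hψ : ∀ u ∈ U, Function.invFunOn (sliceMap y t G) U (sliceMap y t G u) = u :=
    fun u hu => hinj.leftInvOn_invFunOn hu
  have hcd := contDiffOn_leftInverse (h.finOpen G hG t) (h.contDiffOn_sliceMap t hG)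
    (fun u hu => h.exists_equiv hG hG0 hu) hψ
  refine ((hf G hG t).comp hcd ?_).congr ?_
  · rintro _ ⟨u, hu, rfl⟩
    rw [hψ u hu]
    exact hu
  · rintro _ ⟨u, hu, rfl⟩
    simp only [Function.comp_apply]
    rw [hψ u hu, updateFinset_sliceMap hG0]

/-- The chain rule for the change of variables. -/
lemma IsChange.pd_comp (h : IsChange J D y) {f : Pt → ℝ}
    (hf : SmoothFun (negTimes J) (newPoint y '' D) f) {n : ℤ} (hn : n ∈ J) {t : Pt} (ht : t ∈ D) :
    pd n (fun t => f (newPoint y t)) t = (if n = 0 then 0 else pd (-n) f (newPoint y t)) +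
      pd n (PowerSeries.coeff 0 y) t * pd 0 f (newPoint y t) := by
  have hG : (({0, n} : Finset ℤ) : Set ℤ) ⊆ J := by
    intro i hi
    simp at hi
    rcases hi with rfl | rfl
    · exact h.zero_mem
    · exact hn
  have htu : Function.updateFinset t {0, n} (fun i => t i) = t := Function.updateFinset_restrict t
  have hG0 : (0 : ℤ) ∈ ({0, n} : Finset ℤ) := by simp
  have hnG : n ∈ ({0, n} : Finset ℤ) := by simp
  set G : Finset ℤ := {0, n}
  set u : G → ℝ := fun i => t i
  have hu : Function.updateFinset t G u ∈ D := by rwa [htu]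
  have hu' : Function.updateFinset (negPt t) (negIdx G) (sliceMap y t G u) ∈ newPoint y '' D := by
    rw [updateFinset_sliceMap hG0]
    exact ⟨_, hu, rfl⟩
  have hG' := negIdx_subset' hG
  have hD' := h.finOpen_image
  have h1 := ((hf.contDiffAt hD' hG' hu').differentiableAt (by simp)).hasFDerivAt.comp u
    (h.hasFDerivAt_sliceMap hG hu)
  have h0' : (0 : ℤ) ∈ negIdx G := by simpa using hG0
  have hn' : -n ∈ negIdx G := by simpa using hnG
  -- Moving tₙ moves s₋ₙ at unit speed and y at speed ∂ₙ y₀. For n = 0 only the motion of y remains.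
  have hL : sliceDeriv y t G u (Pi.single ⟨n, hnG⟩ 1) =
      (if n = 0 then 0 else Pi.single ⟨-n, hn'⟩ 1) +
        pd n (PowerSeries.coeff 0 y) t • (Pi.single ⟨0, h0'⟩ 1 : negIdx G → ℝ) := by
    have h3 := h.smooth.pd_slice h.finOpen hG hu hnG
    rw [htu] at h3
    ext i
    by_cases hi : (i : ℤ) = 0
    · obtain ⟨i, hi'⟩ := i
      dsimp only at hi
      subst hi
      have e0 : sliceDeriv y t G u (Pi.single ⟨n, hnG⟩ 1) ⟨0, hi'⟩ =
          pd n (PowerSeries.coeff 0 y) t := by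
        rw [h3]
        simp only [sliceDeriv, ContinuousLinearMap.coe_pi', if_true]
      rw [e0]
      by_cases hn0 : n = 0
      · simp [hn0]
      · have : (⟨0, hi'⟩ : negIdx G) ≠ ⟨-n, hn'⟩ := by
          simpa [Subtype.ext_iff] using hn0
        simp [hn0, this]
    · have h0i : i ≠ ⟨0, h0'⟩ := fun h' => hi (congrArg Subtype.val h')
      by_cases hn0 : n = 0
      · subst hn0
        have : (⟨-(i : ℤ), mem_negIdx.mp i.2⟩ : G) ≠ ⟨0, hnG⟩ := by
          simpa [Subtype.ext_iff] using hi
        simp [sliceDeriv, hi, h0i, this]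
      · by_cases hin : i = ⟨-n, hn'⟩
        · subst hin
          simp [sliceDeriv, hn0]
        · have : (⟨-(i : ℤ), mem_negIdx.mp i.2⟩ : G) ≠ ⟨n, hnG⟩ := by
            intro h'
            refine hin (Subtype.ext ?_)
            have := congrArg Subtype.val h'
            dsimp only at this ⊢
            omega
          simp [sliceDeriv, hi, h0i, hn0, hin, this]
  have h2 : (fun v : negIdx G → ℝ => f (Function.updateFinset (negPt t) (negIdx G) v)) ∘
      sliceMap y t G = fun u => f (newPoint y (Function.updateFinset t G u)) := by
    ext v
    simp [updateFinset_sliceMap hG0]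
  rw [h2] at h1
  have h4 := (h.smooth_comp hf).pd_slice h.finOpen hG hu hnG
  rw [h1.fderiv, ContinuousLinearMap.comp_apply, hL, map_add, map_smul,
    ← hf.pd_slice hD' hG' hu' h0', updateFinset_sliceMap hG0, htu, smul_eq_mul] at h4
  rw [h4]
  congr 1
  split_ifs with hn0
  · simp
  · rw [← hf.pd_slice hD' hG' hu' hn', updateFinset_sliceMap hG0, htu]

/-- The pull-back of smooth functions of the new variables. -/
def IsChange.pullback (h : IsChange J D y) :
    smoothRing (negTimes J) (newPoint y '' D) →ₐ[ℝ] smoothRing J D where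
  toFun f := (h.smooth_comp (smoothFun_extendZero f)).toRing
  map_one' := by
    ext t
    exact extendZero_apply (1 : (newPoint y '' D) → ℝ) ⟨_, t.1, t.2, rfl⟩
  map_mul' f g := by
    ext t
    have h1 (f : (newPoint y '' D) → ℝ) := extendZero_apply f ⟨_, t.1, t.2, rfl⟩
    simp [h1]
  map_zero' := by
    ext t
    exact extendZero_apply (0 : (newPoint y '' D) → ℝ) ⟨_, t.1, t.2, rfl⟩
  map_add' f g := by
    ext t
    have h1 (f : (newPoint y '' D) → ℝ) := extendZero_apply f ⟨_, t.1, t.2, rfl⟩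
    simp [h1]
  commutes' c := by
    ext t
    exact extendZero_apply (fun _ : (newPoint y '' D) => c) ⟨_, t.1, t.2, rfl⟩

lemma IsChange.pullback_apply (h : IsChange J D y)
    (f : smoothRing (negTimes J) (newPoint y '' D)) (t : D) :
    (h.pullback f).1 t = extendZero f.1 (newPoint y t) := rfl

lemma IsChange.pullback_injective (h : IsChange J D y) : Function.Injective h.pullback := by
  intro f g hfg
  ext ⟨_, t, ht, rfl⟩
  have := congrFun (congrArg Subtype.val hfg) ⟨t, ht⟩
  rw [h.pullback_apply, h.pullback_apply] at this
  rwa [← extendZero_apply f.1, ← extendZero_apply g.1]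

lemma IsChange.pullback_surjective (h : IsChange J D y) : Function.Surjective h.pullback := by
  intro g
  set f : Pt → ℝ := fun p => extendZero g.1 (Function.invFunOn (newPoint y) D p) with hf
  have hfg : ∀ t ∈ D, f (newPoint y t) = extendZero g.1 t := fun t ht => by
    rw [hf]
    simp only
    rw [h.injOn.leftInvOn_invFunOn ht]
  have hs : SmoothFun (negTimes J) (newPoint y '' D) f :=
    h.smooth_of_comp ((smoothFun_extendZero g).congr fun t ht => (hfg t ht).symm)
  refine ⟨hs.toRing, ?_⟩
  ext t
  rw [h.pullback_apply, ← extendZero_apply g.1, ← hfg t t.2]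
  exact extendZero_apply hs.toRing.1 ⟨_, t.1, t.2, rfl⟩

lemma IsChange.der_pullback (h : IsChange J D y) {n : ℤ} (hn : n ∈ J)
    (f : smoothRing (negTimes J) (newPoint y '' D)) :
    der h.finOpen hn (h.pullback f) =
      (if n = 0 then 0 else h.pullback (der h.finOpen_image (n := -n)
        (by simpa [negTimes] using hn) f)) +
      der h.finOpen hn h.smooth.toRing *
        h.pullback (der h.finOpen_image (zero_mem_negTimes h.zero_mem) f) := by
  ext t
  have hd {k : ℤ} (hk : k ∈ negTimes J) : (h.pullback (der h.finOpen_image hk f)).1 t =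
      pd k (extendZero f.1) (newPoint y t) := by
    rw [h.pullback_apply]
    exact extendZero_apply _ (⟨_, t.1, t.2, rfl⟩ : newPoint y '' D)
  have h1 := h.pd_comp (smoothFun_extendZero f) hn t.2
  have h2 : (der h.finOpen hn (h.pullback f)).1 t =
      pd n (fun t => extendZero f.1 (newPoint y t)) t :=
    pd_congr h.finOpen hn (eqOn_extendZero fun t => h.pullback_apply f t) t.2
  have h3 : (der h.finOpen hn h.smooth.toRing).1 t = pd n (PowerSeries.coeff 0 y) t :=
    pd_congr h.finOpen hn (eqOn_extendZero fun t => rfl) t.2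
  rw [h2, h1, ← h3, ← hd (zero_mem_negTimes h.zero_mem)]
  by_cases hn0 : n = 0
  · simp [hn0]
  · simp only [hn0, if_false]
    rw [← hd (by simpa [negTimes] using hn)]
    rfl

end Reciprocal

/-! ## Potentials of closed one-forms on convex domains -/

section Potential

variable {J : Set ℤ} {D : Set Pt}

/-- Two points of `D` are related if they differ in finitely many variables with index in `J`. -/
def finDiffSetoid (J : Set ℤ) (D : Set Pt) : Setoid D where
  r p q := ∃ F : Finset ℤ, (F : Set ℤ) ⊆ J ∧ ∀ i ∉ F, p.1 i = q.1 i
  iseqv :=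
    { refl := fun p => ⟨∅, by simp, fun _ _ => rfl⟩
      symm := fun ⟨F, hF, h⟩ => ⟨F, hF, fun i hi => (h i hi).symm⟩
      trans := fun ⟨F, hF, h⟩ ⟨G, hG, h'⟩ => ⟨F ∪ G, by simp [hF, hG], fun i hi => by
        rw [Finset.notMem_union] at hi
        exact (h i hi.1).trans (h' i hi.2)⟩ }

/-- A base point in each class. -/
def basePt (J : Set ℤ) {D : Set Pt} (p : D) : D :=
  (Quotient.mk (finDiffSetoid J D) p).out

lemma basePt_rel (p : D) : ∃ F : Finset ℤ, (F : Set ℤ) ⊆ J ∧ ∀ i ∉ F, (basePt J p).1 i = p.1 i :=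
  Quotient.mk_out (s := finDiffSetoid J D) p

/-- The base point is thus constant along slices. Segments from it move only finitely many
variables, so all analysis stays finite-dimensional; the constants of integration in different
classes are unrelated. -/
lemma basePt_eq {p q : D} {F : Finset ℤ} (hF : (F : Set ℤ) ⊆ J) (h : ∀ i ∉ F, p.1 i = q.1 i) :
    basePt J p = basePt J q := by
  unfold basePt
  congr 1
  exact Quotient.sound (s := finDiffSetoid J D) ⟨F, hF, h⟩

/-- The integral of the one-form `∑ αₙ dtₙ` along the segment from the base point. -/
def potential (J : Set ℤ) (D : Set Pt) (α : ℤ → Pt → ℝ) (t : Pt) : ℝ :=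
  open Classical in
  if h : t ∈ D then ∫ τ in (0 : ℝ)..1, ∑ᶠ n, α n (AffineMap.lineMap (basePt J ⟨t, h⟩).1 t τ) *
    (t n - (basePt J ⟨t, h⟩).1 n) else 0

/-- The one-form `∑ αₙ dtₙ` on a slice. -/
def sliceForm (α : ℤ → Pt → ℝ) (s : Pt) (G : Finset ℤ) (u : G → ℝ) : (G → ℝ) →L[ℝ] ℝ :=
  ∑ g : G, α g (Function.updateFinset s G u) • ContinuousLinearMap.proj g

lemma lineMap_updateFinset (s : Pt) (G : Finset ℤ) (u v : G → ℝ) (τ : ℝ) :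
    AffineMap.lineMap (Function.updateFinset s G u) (Function.updateFinset s G v) τ =
      Function.updateFinset s G (AffineMap.lineMap u v τ) := by
  ext i
  by_cases hi : i ∈ G <;> simp [AffineMap.lineMap_apply, Function.updateFinset, hi]

lemma updateFinset_eq_self (s : Pt) (G : Finset ℤ) :
    Function.updateFinset s G (fun i => s i) = s := Function.updateFinset_restrict s

lemma convex_slice (hc : Convex ℝ D) (s : Pt) (G : Finset ℤ) :
    Convex ℝ {u : G → ℝ | Function.updateFinset s G u ∈ D} := by
  rw [convex_iff_segment_subset]
  intro u hu v hv
  rw [segment_eq_image_lineMap]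
  rintro _ ⟨τ, hτ, rfl⟩
  have := hc.lineMap_mem hu hv hτ
  rwa [lineMap_updateFinset] at this

lemma potential_slice (α : ℤ → Pt → ℝ) {s : D} {G : Finset ℤ} {u : G → ℝ}
    (hu : Function.updateFinset s.1 G u ∈ D) (hs : basePt J ⟨_, hu⟩ = s) :
    potential J D α (Function.updateFinset s.1 G u) =
      curveIntegral (sliceForm α s.1 G) (.segment (fun i : G => s.1 i) u) := by
  rw [potential, dif_pos hu, hs, curveIntegral_segment]
  congr 1
  ext τ
  have h1 : AffineMap.lineMap s.1 (Function.updateFinset s.1 G u) τ =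
      Function.updateFinset s.1 G (AffineMap.lineMap (fun i : G => s.1 i) u τ) := by
    rw [← lineMap_updateFinset, updateFinset_eq_self]
  -- Only directions in `G` contribute: along a frozen coordinate the segment is constant, so its
  -- increment is zero.
  rw [h1, finsum_eq_sum_of_support_subset (s := G), ← Finset.sum_coe_sort]
  · simp [sliceForm, Function.updateFinset]
  · intro n hn
    by_contra h
    have : n ∉ G := h
    simp [Function.updateFinset, this] at hn

variable {α : ℤ → Pt → ℝ}

lemma contDiffOn_sliceForm (hα : ∀ n ∈ J, SmoothFun J D (α n)) (s : Pt) {G : Finset ℤ}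
    (hG : (G : Set ℤ) ⊆ J) :
    ContDiffOn ℝ ∞ (sliceForm α s G) {u : G → ℝ | Function.updateFinset s G u ∈ D} := by
  unfold sliceForm
  exact ContDiffOn.sum fun g _ => (hα g (hG g.2) G hG s).smul contDiffOn_const

lemma fderiv_sliceForm_symm (hD : FinOpen J D) (hα : ∀ n ∈ J, SmoothFun J D (α n))
    (hcl : ∀ m ∈ J, ∀ n ∈ J, Set.EqOn (pd m (α n)) (pd n (α m)) D) {s : Pt} {G : Finset ℤ}
    (hG : (G : Set ℤ) ⊆ J) {u : G → ℝ} (hu : Function.updateFinset s G u ∈ D) (v w : G → ℝ) :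
    fderiv ℝ (sliceForm α s G) u v w = fderiv ℝ (sliceForm α s G) u w v := by
  have key (v w : G → ℝ) : fderiv ℝ (sliceForm α s G) u v w =
      ∑ g : G, ∑ h : G, v h * w g * pd h (α g) (Function.updateFinset s G u) := by
    have h1 : HasFDerivAt (sliceForm α s G) (∑ g : G,
        (fderiv ℝ (fun u => α g (Function.updateFinset s G u)) u).smulRight
          (ContinuousLinearMap.proj g : (G → ℝ) →L[ℝ] ℝ)) u := by
      unfold sliceForm
      exact HasFDerivAt.fun_sum fun g _ => ((((hα g (hG g.2)).contDiffAt hD hG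
        hu).differentiableAt (by simp)).hasFDerivAt).smul_const
        (ContinuousLinearMap.proj g : (G → ℝ) →L[ℝ] ℝ)
    rw [h1.fderiv]
    simp only [sum_apply, ContinuousLinearMap.smulRight_apply,
      smul_apply, ContinuousLinearMap.proj_apply, smul_eq_mul]
    refine Finset.sum_congr rfl fun g _ => ?_
    have h2 : v = ∑ h : G, v h • (Pi.single h 1 : G → ℝ) := by
      ext i
      simp [Finset.sum_apply, Pi.single_apply]
    conv_lhs => rw [h2]
    rw [map_sum, Finset.sum_mul]
    refine Finset.sum_congr rfl fun h _ => ?_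
    rw [map_smul, ← (hα g (hG g.2)).pd_slice hD hG hu h.2, smul_eq_mul]
    ring
  rw [key, key, Finset.sum_comm]
  refine Finset.sum_congr rfl fun g _ => Finset.sum_congr rfl fun h _ => ?_
  rw [hcl g (hG g.2) h (hG h.2) hu]
  ring

/-- The Poincaré lemma on a convex slice: closedness is the symmetry of the derivative of the form.
-/
lemma hasFDerivAt_segment (hD : FinOpen J D) (hc : Convex ℝ D)
    (hα : ∀ n ∈ J, SmoothFun J D (α n))
    (hcl : ∀ m ∈ J, ∀ n ∈ J, Set.EqOn (pd m (α n)) (pd n (α m)) D) (s : D) {G : Finset ℤ}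
    (hG : (G : Set ℤ) ⊆ J) {u : G → ℝ} (hu : Function.updateFinset s.1 G u ∈ D) :
    HasFDerivAt (fun u => curveIntegral (sliceForm α s.1 G) (.segment (fun i : G => s.1 i) u))
      (sliceForm α s.1 G u) u := by
  have ho := hD G hG s.1
  have hs : (fun i : G => s.1 i) ∈ {u : G → ℝ | Function.updateFinset s.1 G u ∈ D} := by
    have := s.2
    rw [← updateFinset_eq_self s.1 G] at this
    exact this
  refine ((convex_slice hc s.1 G).hasFDerivWithinAt_curveIntegral_segment_of_hasFDerivWithinAt_symmetric
    (dω := fderiv ℝ (sliceForm α s.1 G)) (fun x hx => ?_) (fun a ha x _ y _ => ?_) hs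
    hu).hasFDerivAt (ho.mem_nhds hu)
  · exact (((contDiffOn_sliceForm hα s.1 hG).contDiffAt (ho.mem_nhds hx)).differentiableAt
      (by simp)).hasFDerivAt.hasFDerivWithinAt
  · exact fderiv_sliceForm_symm hD hα hcl hG ha x y

/-- The derivative of the integral is the smooth form itself, which gives smoothness of all orders.
-/
lemma contDiffOn_segment (hD : FinOpen J D) (hc : Convex ℝ D)
    (hα : ∀ n ∈ J, SmoothFun J D (α n))
    (hcl : ∀ m ∈ J, ∀ n ∈ J, Set.EqOn (pd m (α n)) (pd n (α m)) D) (s : D) {G : Finset ℤ}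
    (hG : (G : Set ℤ) ⊆ J) :
    ContDiffOn ℝ ∞ (fun u => curveIntegral (sliceForm α s.1 G) (.segment (fun i : G => s.1 i) u))
      {u : G → ℝ | Function.updateFinset s.1 G u ∈ D} := by
  rw [contDiffOn_infty_iff_fderiv_of_isOpen (hD G hG s.1)]
  refine ⟨fun u hu => (hasFDerivAt_segment hD hc hα hcl s hG
    hu).differentiableAt.differentiableWithinAt, ?_⟩
  exact (contDiffOn_sliceForm hα s.1 hG).congr fun u hu =>
    (hasFDerivAt_segment hD hc hα hcl s hG hu).fderiv

lemma smoothFun_potential (hD : FinOpen J D) (hc : Convex ℝ D)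
    (hα : ∀ n ∈ J, SmoothFun J D (α n))
    (hcl : ∀ m ∈ J, ∀ n ∈ J, Set.EqOn (pd m (α n)) (pd n (α m)) D) :
    SmoothFun J D (potential J D α) := by
  intro F hF t
  by_cases hne : ∃ u₀ : F → ℝ, Function.updateFinset t F u₀ ∈ D
  · obtain ⟨u₀, hu₀⟩ := hne
    obtain ⟨G₀, hG₀, hG₀'⟩ := basePt_rel (J := J) (⟨_, hu₀⟩ : D)
    set s := basePt J (⟨_, hu₀⟩ : D)
    -- The base point may differ from `t` outside `F`. The slice through `t` is therefore placed
    -- inside the larger slice through the base point with directions F ∪ G₀.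
    have hG : ((F ∪ G₀ : Finset ℤ) : Set ℤ) ⊆ J := by simp [hF, hG₀]
    have hst (u : F → ℝ) : Function.updateFinset s.1 (F ∪ G₀) (sliceIncl t F (F ∪ G₀) u) =
        Function.updateFinset t F u := by
      ext i
      by_cases hi : i ∈ F ∪ G₀
      · simp only [Function.updateFinset, hi, dif_pos, sliceIncl]
      · rw [Finset.notMem_union] at hi
        have := hG₀' i hi.2
        simp only [Function.updateFinset, hi, dif_neg, not_false_eq_true, Finset.mem_union,
          or_self] at this ⊢
        exact this
    have hcomp := (contDiffOn_segment hD hc hα hcl s hG).comp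
      (contDiff_sliceIncl t F (F ∪ G₀)).contDiffOn
      (s := {u : F → ℝ | Function.updateFinset t F u ∈ D}) (fun u hu => by
        change Function.updateFinset s.1 (F ∪ G₀) (sliceIncl t F (F ∪ G₀) u) ∈ D
        rw [hst]
        exact hu)
    refine hcomp.congr fun u hu => ?_
    have hu' : Function.updateFinset s.1 (F ∪ G₀) (sliceIncl t F (F ∪ G₀) u) ∈ D := by
      rw [hst]; exact hu
    rw [Function.comp_apply, ← potential_slice (J := J) α hu', hst]
    refine basePt_eq hF fun i hi => ?_
    change Function.updateFinset s.1 (F ∪ G₀) (sliceIncl t F (F ∪ G₀) u) i =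
      Function.updateFinset t F u₀ i
    rw [hst]
    simp [Function.updateFinset, hi]
  · have : {u : F → ℝ | Function.updateFinset t F u ∈ D} = ∅ := by
      ext u
      simpa using fun hu => hne ⟨u, hu⟩
    rw [this]
    exact contDiffOn_empty

lemma pd_potential (hD : FinOpen J D) (hc : Convex ℝ D)
    (hα : ∀ n ∈ J, SmoothFun J D (α n))
    (hcl : ∀ m ∈ J, ∀ n ∈ J, Set.EqOn (pd m (α n)) (pd n (α m)) D) {n : ℤ} (hn : n ∈ J) :
    Set.EqOn (pd n (potential J D α)) (α n) D := by
  intro t ht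
  obtain ⟨G₀, hG₀, hG₀'⟩ := basePt_rel (J := J) (⟨t, ht⟩ : D)
  set s := basePt J (⟨t, ht⟩ : D) with hs
  have hG : ((insert n G₀ : Finset ℤ) : Set ℤ) ⊆ J := by
    simp [Set.insert_subset_iff, hn, hG₀]
  have hnG : n ∈ insert n G₀ := Finset.mem_insert_self _ _
  have hagree : ∀ i ∉ insert n G₀, s.1 i = t i := fun i hi =>
    hG₀' i fun h => hi (Finset.mem_insert_of_mem h)
  set G : Finset ℤ := insert n G₀
  set u : G → ℝ := fun i => t i with hudef
  have htu : Function.updateFinset s.1 G u = t := by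
    ext i
    by_cases hi : i ∈ G
    · simp [Function.updateFinset, hi, u]
    · simp [Function.updateFinset, hi, hagree i hi]
  have hu : Function.updateFinset s.1 G u ∈ D := by rwa [htu]
  have hbase {v : G → ℝ} (hv : Function.updateFinset s.1 G v ∈ D) : basePt J ⟨_, hv⟩ = s :=
    basePt_eq hG fun i hi => by
      simp [Function.updateFinset, hi, hagree i hi]
  have hpd := (smoothFun_potential hD hc hα hcl).pd_slice hD hG hu hnG
  have hev : (fun v : G → ℝ => potential J D α (Function.updateFinset s.1 G v)) =ᶠ[nhds u]
      fun v => curveIntegral (sliceForm α s.1 G) (.segment (fun i : G => s.1 i) v) := by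
    filter_upwards [(hD G hG s.1).mem_nhds hu] with v hv using potential_slice α hv (hbase hv)
  rw [hev.fderiv_eq, (hasFDerivAt_segment hD hc hα hcl s hG hu).fderiv, htu] at hpd
  rw [hpd, sliceForm, htu]
  simp [Pi.single_apply]

end Potential

/-! ## The transformed hierarchy -/

section Covariance

variable {G : Type*} [CommRing G] [Algebra ℝ G] (δ : Derivation ℝ G G)

lemma derivation_two (D : Derivation ℝ G G) : D 2 = 0 := by simpa using D.map_natCast 2

/-- Covariance of the quadratic expression under `∂ ↦ γ ∂`. -/
lemma quadD_covariant (κ P Q γ f : G) :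
    quadD δ κ P Q (γ * f) = (γ ^ 2 * P - κ * Q * (2 * γ * δ (δ γ) - δ γ ^ 2)) * f ^ 2 -
      κ * Q * (2 * f * (γ * δ (γ * δ f)) - (γ * δ f) ^ 2) := by
  simp only [quadD, Derivation.leibniz, smul_eq_mul, map_add]
  ring

/-- Covariance of the operators of the hierarchy under `∂ ↦ γ ∂`. -/
lemma dop_covariant {k : G} (hk : δ k = 0) (γ w f : G) :
    2 * (γ ^ 2 * w - k * (2 * γ * δ (δ γ) - δ γ ^ 2)) * (γ * δ f) +
      γ * δ (γ ^ 2 * w - k * (2 * γ * δ (δ γ) - δ γ ^ 2)) * f -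
      2 * k * (γ * δ (γ * δ (γ * δ f))) =
    γ ^ 2 * (2 * w * δ (γ * f) + δ w * (γ * f) - 2 * k * δ (δ (δ (γ * f)))) := by
  simp only [Derivation.leibniz, Derivation.leibniz_pow, smul_eq_mul, map_add, map_sub, hk,
    derivation_two, nsmul_eq_mul, pow_one, Nat.add_one_sub_one]
  push_cast
  ring

/-- The transformed coefficients evolve by the transformed flow. -/
lemma transformed_flow (τ : Derivation ℝ G G) (hcomm : ∀ f, δ (τ f) = τ (δ f)) {k : G}
    (hk : δ k = 0) (hkτ : τ k = 0) {γ β : G} (w : G) (hγ : τ γ = β * δ γ - δ β * γ) :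
    τ (γ ^ 2 * w - k * (2 * γ * δ (δ γ) - δ γ ^ 2)) -
      β * δ (γ ^ 2 * w - k * (2 * γ * δ (δ γ) - δ γ ^ 2)) =
    γ ^ 2 * (τ w - (2 * w * δ β + δ w * β - 2 * k * δ (δ (δ β)))) := by
  have h1 : τ (δ γ) = δ (β * δ γ - δ β * γ) := by rw [← hcomm, hγ]
  have h2 : τ (δ (δ γ)) = δ (δ (β * δ γ - δ β * γ)) := by rw [← hcomm, h1]
  simp only [Derivation.leibniz, Derivation.leibniz_pow, smul_eq_mul, map_add, map_sub, hk, hkτ,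
    derivation_two, nsmul_eq_mul, pow_one, Nat.add_one_sub_one, h1, h2, hγ]
  push_cast
  ring

end Covariance

section TransformedHierarchy

open PowerSeries

variable {R : Type*} [CommRing R] [Algebra ℝ R]

/-- The expression `γ² w - (ε² / 4) α (2 γ γₓₓ - γₓ²)`. -/
def transD (δ : Derivation ℝ R R) (α : ℝ) (w γ : PowerSeries R) : PowerSeries R :=
  γ ^ 2 * w - (1 / 4 * α : ℝ) •
    ((X : PowerSeries R) ^ 2 * (2 * γ * mapDer δ (mapDer δ γ) - mapDer δ γ ^ 2))

/-- The constant `(ε² / 4) α`. -/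
def quarterCoeff (R : Type*) [CommRing R] [Algebra ℝ R] (α : ℝ) : PowerSeries R :=
  (1 / 4 * α : ℝ) • (X : PowerSeries R) ^ 2

@[simp] lemma mapDer_quarterCoeff (δ : Derivation ℝ R R) (α : ℝ) :
    mapDer δ (quarterCoeff R α) = 0 := by
  simp [quarterCoeff, Derivation.leibniz_pow]

lemma transD_eq (δ : Derivation ℝ R R) (α : ℝ) (w γ : PowerSeries R) : transD δ α w γ =
    γ ^ 2 * w - quarterCoeff R α * (2 * γ * mapDer δ (mapDer δ γ) - mapDer δ γ ^ 2) := by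
  rw [transD, quarterCoeff, smul_mul_assoc]

lemma dopD_eq (δ : Derivation ℝ R R) (α : ℝ) (w f : PowerSeries R) : dopD δ α w f =
    2 * w * mapDer δ f + mapDer δ w * f -
      2 * quarterCoeff R α * mapDer δ (mapDer δ (mapDer δ f)) := by
  have h2 : (2 : PowerSeries R) = (2 : ℝ) • 1 := by
    rw [← Algebra.algebraMap_eq_smul_one, map_ofNat]
  have h3 : 2 * quarterCoeff R α = (1 / 2 * α : ℝ) • (X : PowerSeries R) ^ 2 := by
    rw [quarterCoeff, h2, smul_mul_smul_comm, one_mul]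
    congr 1
    ring
  rw [dopD, h3, smul_mul_assoc]

lemma dopD_sub (δ : Derivation ℝ R R) (α : ℝ) (w f g : PowerSeries R) :
    dopD δ α w (f - g) = dopD δ α w f - dopD δ α w g := by
  simp only [dopD_eq, map_sub]
  ring

lemma dopD_one (δ : Derivation ℝ R R) (α : ℝ) (w : PowerSeries R) :
    dopD δ α w 1 = mapDer δ w := by
  simp [dopD]

variable {R' : Type*} [CommRing R'] [Algebra ℝ R'] {δ : Derivation ℝ R R}
  {δ' : Derivation ℝ R' R'} {Φ : PowerSeries R' →ₐ[ℝ] PowerSeries R} {r : ℕ} {a : ℤ → ℝ}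
  {W : ℤ → PowerSeries R} {b c : PowerSeries (PowerSeries R)} {u : PowerSeries R}
  {V : ℤ → PowerSeries R'} {b' c' : PowerSeries (PowerSeries R')}

/-- The series `b'`, `c'` and the coefficients `V` are the transforms of `b`, `c` and `W` under the
formal change of variables `Φ`, where `u = 1 / c₀`. -/
structure Transforms (δ : Derivation ℝ R R) (δ' : Derivation ℝ R' R')
    (Φ : PowerSeries R' →ₐ[ℝ] PowerSeries R) (r : ℕ) (a : ℤ → ℝ) (W : ℤ → PowerSeries R)
    (b c : PowerSeries (PowerSeries R)) (u : PowerSeries R) (V : ℤ → PowerSeries R')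
    (b' c' : PowerSeries (PowerSeries R')) : Prop where
  inj : Function.Injective Φ
  map_X : Φ X = X
  map_der : ∀ f, Φ (mapDer δ' f) = coeff 0 c * mapDer δ (Φ f)
  u_mul : u * coeff 0 c = 1
  map_V : ∀ k, Φ (V k) = transD δ (a (r - k)) (W (r - k)) (coeff 0 c)
  map_b : ∀ j, Φ (coeff j b') = u * coeff j c
  map_c : ∀ j, Φ (coeff j c') = u * coeff j b

/-- After applying the injective Φ, ∂_y is γ ∂ₓ and F = γ Ψ(f), so covariance reduces the claim to
the old equation. The choice p(j) = j yields the equation for b', and p(j) = r - j the one for c'.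
-/
lemma Transforms.quad_gen (h : Transforms δ δ' Φ r a W b c u V b' c') {p : ℕ → ℤ}
    {F : PowerSeries (PowerSeries R)} {f : PowerSeries (PowerSeries R')}
    (hf : ∀ j, Φ (coeff j f) = u * coeff j F)
    (hF : quadD (mapDer (mapDer δ)) (quarterEpsSq R) (PowerSeries.mk fun j => W (p j))
      (PowerSeries.mk fun j => a (p j) • (1 : PowerSeries R)) F = 1) :
    quadD (mapDer (mapDer δ')) (quarterEpsSq R') (PowerSeries.mk fun j => V (r - p j))
      (PowerSeries.mk fun j => a (p j) • (1 : PowerSeries R')) f = 1 := by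
  set Ψ : PowerSeries (PowerSeries R') →+* PowerSeries (PowerSeries R) :=
    PowerSeries.map Φ.toRingHom with hΨ
  have hcoeff (j : ℕ) (g) : coeff j (Ψ g) = Φ (coeff j g) := by rw [hΨ, coeff_map]; rfl
  have hinj : Function.Injective Ψ := fun g₁ g₂ hg => by
    ext1 j
    exact h.inj (by rw [← hcoeff, hg, hcoeff])
  apply hinj
  have hder (g) : Ψ (mapDer (mapDer δ') g) = C (coeff 0 c) * mapDer (mapDer δ) (Ψ g) := by
    ext1 j
    rw [hcoeff, coeff_mapDer, h.map_der, coeff_C_mul, coeff_mapDer, hcoeff]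
  have hκ : Ψ (quarterEpsSq R') = quarterEpsSq R := by
    rw [hΨ, quarterEpsSq, PowerSeries.map_C, quarterEpsSq]
    congr 1
    change Φ _ = _
    rw [map_smul, map_pow, h.map_X]
  have hQ : Ψ (PowerSeries.mk fun j => a (p j) • (1 : PowerSeries R')) =
      PowerSeries.mk fun j => a (p j) • (1 : PowerSeries R) := by
    ext1 j
    rw [hcoeff, coeff_mk, coeff_mk, map_smul, map_one]
  have hf' : F = C (coeff 0 c) * Ψ f := by
    ext1 j
    rw [coeff_C_mul, hcoeff, hf, ← mul_assoc, mul_comm (coeff 0 c), h.u_mul, one_mul]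
  have hP : Ψ (PowerSeries.mk fun j => V (r - p j)) = C (coeff 0 c) ^ 2 *
      (PowerSeries.mk fun j => W (p j)) - quarterEpsSq R *
        (PowerSeries.mk fun j => a (p j) • (1 : PowerSeries R)) *
        (2 * C (coeff 0 c) * mapDer (mapDer δ) (mapDer (mapDer δ) (C (coeff 0 c))) -
          mapDer (mapDer δ) (C (coeff 0 c)) ^ 2) := by
    have h2 : (2 : PowerSeries (PowerSeries R)) = C 2 := (map_ofNat _ 2).symm
    rw [quarterEpsSq, h2]
    simp only [mapDer_C, ← map_mul, ← map_pow, ← map_sub]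
    ext1 j
    rw [hcoeff, coeff_mk, h.map_V, map_sub, coeff_C_mul, mul_assoc, coeff_C_mul, mul_comm,
      mul_comm (PowerSeries.mk _) (C _), coeff_C_mul, coeff_mk, coeff_mk, sub_sub_cancel, transD]
    simp only [mul_smul_comm, smul_mul_assoc, mul_one, smul_smul]
    rw [mul_comm (W (p j)), mul_comm (a (p j))]
  rw [map_one, ← hF]
  conv_rhs => rw [hf', quadD_covariant, ← hP]
  rw [quadD]
  simp only [map_sub, map_mul, map_pow, map_ofNat, hder, hκ, hQ]

lemma Transforms.quad_b (h : Transforms δ δ' Φ r a W b c u V b' c') (hF : Fields δ r a W b c) :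
    quadD (mapDer (mapDer δ')) (quarterEpsSq R') (PowerSeries.mk fun j => V ((r : ℤ) - j))
      (PowerSeries.mk fun j => a ((r : ℤ) - ((r : ℤ) - j)) • (1 : PowerSeries R')) b' = 1 := by
  have := h.quad_gen h.map_b hF.quad_c
  simpa only [sub_sub_cancel] using this

lemma Transforms.quad_c (h : Transforms δ δ' Φ r a W b c u V b' c') (hF : Fields δ r a W b c) :
    quadD (mapDer (mapDer δ')) (quarterEpsSq R') (PowerSeries.mk fun j => V j)
      (PowerSeries.mk fun j => a ((r : ℤ) - j) • (1 : PowerSeries R')) c' = 1 := by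
  have := h.quad_gen h.map_c hF.quad_b
  simpa only [sub_sub_cancel] using this

lemma Transforms.b_zero (h : Transforms δ δ' Φ r a W b c u V b' c') : coeff 0 b' = 1 :=
  h.inj (by rw [h.map_b, h.u_mul, map_one])

/-- This is the λ⁰ coefficient of the quadratic equation for `c`; it is the reason why the new
leading coefficient vʳ is 1. -/
lemma Fields.transD_zero (hF : Fields δ r a W b c) : transD δ (a 0) (W 0) (coeff 0 c) = 1 := by
  have h := congrArg (coeff 0) hF.quad_c
  rw [quadD, quarterEpsSq] at h
  simp only [coeff_zero_eq_constantCoeff_apply, map_sub, map_mul, map_pow, map_one, map_ofNat,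
    constantCoeff_C] at h
  simp only [← coeff_zero_eq_constantCoeff_apply, coeff_mapDer, coeff_mk] at h
  rw [transD, ← h, Nat.cast_zero]
  simp only [mul_smul_comm, smul_mul_assoc, mul_one, smul_smul]
  rw [mul_comm (W 0), mul_comm (a 0)]

lemma Fields.transD_eq_zero (hF : Fields δ r a W b c) {i : ℤ} (hi : i < 0 ∨ (r : ℤ) < i) :
    transD δ (a i) (W i) (coeff 0 c) = 0 := by
  rw [hF.a_eq_zero i hi, hF.W_eq_zero i hi, transD]
  simp

lemma Transforms.V_top (h : Transforms δ δ' Φ r a W b c u V b' c') (hF : Fields δ r a W b c) :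
    V r = 1 :=
  h.inj (by rw [h.map_V, sub_self, hF.transD_zero, map_one])

lemma Transforms.V_eq_zero (h : Transforms δ δ' Φ r a W b c u V b' c')
    (hF : Fields δ r a W b c) {k : ℤ} (hk : k < 0 ∨ (r : ℤ) < k) : V k = 0 :=
  h.inj (by rw [h.map_V, hF.transD_eq_zero (by omega), map_zero])

/-- Here B₀ = 1, so the flow with index 0 is the tautology that it acts as ∂_y. It is treated apart
because y itself, and not a time, is the variable s₀. -/
lemma Transforms.flow_zero (h : Transforms δ δ' Φ r a W b c u V b' c') (hF : Fields δ r a W b c) :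
    IsFlow δ' δ' r (fun i => a (r - i)) V b' c' 0 := by
  intro k
  by_cases hk : 0 ≤ k ∧ k ≤ r
  · obtain ⟨k, rfl⟩ := Int.eq_ofNat_of_zero_le hk.1
    rw [Finset.sum_eq_single k]
    · rw [bcD, if_pos le_rfl, if_pos (by omega)]
      simp only [sub_self, Int.toNat_zero]
      rw [h.b_zero, dopD_one]
    · intro i _ hik
      rw [bcD, if_pos le_rfl, if_neg (by omega), dopD_zero_right]
    · intro hk'
      rw [Finset.mem_range] at hk'
      omega
  · rw [h.V_eq_zero hF (by omega), map_zero, Finset.sum_eq_zero]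
    intro i hi
    rw [Finset.mem_range] at hi
    rw [bcD, if_pos le_rfl, if_neg (by omega), dopD_zero_right]

/-- Reversing λ turns (λⁿ b)₊ into a strictly negative part, which loses the λ⁰ term bₙ = βₙ. For n
< 0 it turns (λⁿ c)₋ into a non-negative part, which gains the λ⁰ term c₋ₙ = -βₙ. In both cases the
correction is -βₙ at m = 0. -/
lemma Transforms.map_bc (h : Transforms δ δ' Φ r a W b c u V b' c') {n : ℤ} (hn : n ≠ 0) (m : ℤ) :
    coeff 0 c * Φ (bcD b' c' (-n) m) = bcD b c n (-m) - if m = 0 then betaD b c n else 0 := by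
  have hu (f : PowerSeries R) : coeff 0 c * (u * f) = f := by
    rw [← mul_assoc, mul_comm (coeff 0 c), h.u_mul, one_mul]
  unfold bcD betaD
  rcases lt_or_gt_of_ne hn with hn | hn
  · rw [if_pos (by omega : 0 ≤ -n), if_neg (by omega : ¬ 0 ≤ n), if_neg (by omega : ¬ 0 ≤ n)]
    by_cases hm : 0 ≤ m ∧ m ≤ -n
    · rw [if_pos hm, h.map_b, hu]
      by_cases hm0 : m = 0
      · subst hm0
        rw [if_neg (by omega), if_pos rfl]
        simp
      · rw [if_pos (by omega), if_neg hm0, sub_zero]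
        congr 2
        omega
    · rw [if_neg hm, if_neg (by omega), if_neg (by omega)]
      simp
  · rw [if_neg (by omega : ¬ 0 ≤ -n), if_pos (by omega : 0 ≤ n), if_pos (by omega : 0 ≤ n)]
    by_cases hm : -n ≤ m ∧ m < 0
    · rw [if_pos hm, h.map_c, hu, if_pos (by omega), if_neg (by omega), sub_zero]
      congr 2
      omega
    · rw [if_neg hm]
      by_cases hm0 : m = 0
      · subst hm0
        rw [if_pos (by omega), if_pos rfl]
        simp
      · rw [if_neg (by omega), if_neg hm0]
        simp

lemma Transforms.map_dop (h : Transforms δ δ' Φ r a W b c u V b' c') (i : ℤ)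
    (f : PowerSeries R') : Φ (dopD δ' (a (r - i)) (V i) f) =
      coeff 0 c ^ 2 * dopD δ (a (r - i)) (W (r - i)) (coeff 0 c * Φ f) := by
  have hq (α : ℝ) : Φ (quarterCoeff R' α) = quarterCoeff R α := by
    rw [quarterCoeff, quarterCoeff, map_smul, map_pow, h.map_X]
  rw [dopD_eq, dopD_eq, ← dop_covariant (mapDer δ) (mapDer_quarterCoeff δ _) (coeff 0 c),
    ← transD_eq, ← h.map_V]
  simp only [map_sub, map_add, map_mul, map_ofNat, h.map_der, hq]

lemma Transforms.flow (h : Transforms δ δ' Φ r a W b c u V b' c') (hF : Fields δ r a W b c)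
    {n : ℤ} (hn : n ≠ 0) {τ : Derivation ℝ R R} {τ' : Derivation ℝ R' R'}
    (hcomm : ∀ f, δ (τ f) = τ (δ f)) (hτ : IsFlow δ τ r a W b c n)
    (hτ' : ∀ f, Φ (mapDer τ' f) = mapDer τ (Φ f) - betaD b c n * mapDer δ (Φ f)) :
    IsFlow δ' τ' r (fun i => a (r - i)) V b' c' (-n) := by
  intro k
  apply h.inj
  have hγ := hF.c_zero_flow hcomm hτ
  -- At fixed y the time derivative is ∂_{tₙ} - βₙ ∂ₓ. By `transformed_flow` it produces γ² times
  -- the old flow minus γ² times the operator applied to βₙ.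
  rw [hτ', h.map_V, transD_eq, transformed_flow (mapDer δ) (mapDer τ)
    (mapDer_comm _ _ hcomm) (mapDer_quarterCoeff δ _) (mapDer_quarterCoeff τ _) _ hγ, ← dopD_eq,
    map_sum, hτ]
  simp only [h.map_dop, h.map_bc hn, dopD_sub]
  rw [← Finset.mul_sum, Finset.sum_sub_distrib, ← Finset.sum_range_reflect]
  congr 2
  · refine Finset.sum_congr rfl fun i hi => ?_
    rw [Finset.mem_range] at hi
    rw [show ((r + 1 - 1 - i : ℕ) : ℤ) = r - i by omega]
    congr 2
    ring
  -- The λ⁰ corrections from `map_bc` contribute only at i = k, where they give the operator applied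
  -- to βₙ. For k outside 0, …, r that operator is zero.
  · by_cases hk : 0 ≤ k ∧ k ≤ r
    · obtain ⟨k, rfl⟩ := Int.eq_ofNat_of_zero_le hk.1
      rw [Finset.sum_eq_single k]
      · rw [if_pos (sub_self _)]
      · intro i _ hik
        rw [if_neg (by omega), dopD_zero_right]
      · intro hk'
        rw [Finset.mem_range] at hk'
        omega
    · rw [hF.a_eq_zero _ (by omega), hF.W_eq_zero _ (by omega), dopD_zero_zero,
        Finset.sum_eq_zero]
      intro i hi
      rw [Finset.mem_range] at hi
      rw [if_neg (by omega), dopD_zero_right]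

end TransformedHierarchy

/-! ## The reciprocal transformation -/

section Final

open PowerSeries

lemma ac_eq_zero {r : ℕ} (a : Fin (r + 1) → ℝ) {i : ℤ} (hi : i < 0 ∨ (r : ℤ) < i) :
    ac a i = 0 := dif_neg (by omega)

lemma wc_eq_zero {r : ℕ} (w : Fin r → Fld) {i : ℤ} (hi : i < 0 ∨ (r : ℤ) < i) : wc w i = 0 := by
  rw [wc, dif_neg (by omega), if_neg (by omega)]

lemma wc_top {r : ℕ} (w : Fin r → Fld) : wc w r = 1 := by
  rw [wc, dif_neg (by omega), if_pos rfl]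

lemma wc_coe {r : ℕ} (w : Fin r → Fld) (i : Fin r) : wc w (i : ℕ) = w i := by
  rw [wc, dif_pos ⟨by omega, by exact_mod_cast i.2⟩]
  simp

lemma ac_rev {r : ℕ} (a : Fin (r + 1) → ℝ) (i : ℤ) :
    ac (fun i => a (Fin.rev i)) i = ac a (r - i) := by
  unfold ac
  by_cases h : 0 ≤ i ∧ i < r + 1
  · rw [dif_pos h, dif_pos (by omega)]
    refine congrArg a (Fin.ext ?_)
    simp only [Fin.val_rev]
    omega
  · rw [dif_neg h, dif_neg (by omega)]

variable {J : Set ℤ} {D : Set Pt}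

/-- Reps for all coefficients `wⁱ`. -/
lemma exists_rep_wc {r : ℕ} {w : Fin r → Fld} {V : ℤ → PowerSeries (smoothRing J D)}
    (hw : ∀ i : Fin r, Rep (w i) (V (i : ℕ))) (h1 : V r = 1)
    (h0 : ∀ i, i < 0 ∨ (r : ℤ) < i → V i = 0) (i : ℤ) : Rep (wc w i) (V i) := by
  by_cases hi : i < 0 ∨ (r : ℤ) < i
  · rw [wc_eq_zero w hi, h0 i hi]
    exact rep_zero
  · by_cases hr : i = r
    · rw [hr, wc_top, h1]
      exact rep_one
    · have := hw ⟨i.toNat, by omega⟩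
      rw [← wc_coe w] at this
      simp only at this
      rwa [show ((i.toNat : ℕ) : ℤ) = i by omega] at this

lemma exists_fields (h0 : (0 : ℤ) ∈ J) (hD : FinOpen J D) {r : ℕ} {a : Fin (r + 1) → ℝ}
    {w : Fin r → Fld} {b c : Gen} (hw : ∀ i, Smooth J D (w i)) (hb : IsPositiveSeries J D a w b)
    (hc : IsNegativeSeries J D a w c) :
    ∃ (W : ℤ → PowerSeries (smoothRing J D)) (B C : PowerSeries (PowerSeries (smoothRing J D))),
      (∀ i, Rep (wc w i) (W i)) ∧ GenRep b B ∧ GenRep c C ∧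
      Fields (der hD h0) r (ac a) W B C := by
  have hwc (i : ℤ) : Smooth J D (wc w i) := by
    unfold wc
    split_ifs
    · exact hw _
    · exact rep_one.smooth
    · exact rep_zero.smooth
  choose W hW using fun i => (hwc i).exists_rep
  obtain ⟨B, hB⟩ := exists_genRep_of_smooth hb.1
  obtain ⟨C, hC⟩ := exists_genRep_of_smooth hc.1
  refine ⟨W, B, C, hW, hB, hC, ?_⟩
  refine ⟨fun i => ac_eq_zero a, fun i hi => ?_, ?_, ?_, ?_⟩
  · exact incl_injective (by rw [← hW i, wc_eq_zero w hi, map_zero, map_zero])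
  · exact ((hB 0).agree_iff rep_one).mp hb.2.1
  · exact ((GenRep.quad hD h0 (genRep_mk fun j => hW _) (genRep_mk fun j => rep_one.smul _)
      hB).agree_iff genRep_one).mp hb.2.2
  · exact ((GenRep.quad hD h0 (genRep_mk fun j => hW _) (genRep_mk fun j => rep_one.smul _)
      hC).agree_iff genRep_one).mp hc.2.2

lemma solvesFlow_iff (h0 : (0 : ℤ) ∈ J) (hD : FinOpen J D) {r : ℕ} {a : Fin (r + 1) → ℝ}
    {w : Fin r → Fld} {b c : Gen} {W : ℤ → PowerSeries (smoothRing J D)}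
    {B C : PowerSeries (PowerSeries (smoothRing J D))} (hW : ∀ i, Rep (wc w i) (W i))
    (hB : GenRep b B) (hC : GenRep c C) {n : ℤ} (hn : n ∈ J) :
    SolvesFlow D a w b c n ↔ IsFlow (der hD h0) (der hD hn) r (ac a) W B C n :=
  forall_congr' fun k => ((hW k).d hD hn).agree_iff
    (rep_sum fun i _ => Rep.dop hD h0 a w i (hW i) (hB.bc hC n (k - i)))

lemma Fields.exists_inverse {R : Type*} [CommRing R] [Algebra ℝ R] {δ : Derivation ℝ R R} {r : ℕ}
    {a : ℤ → ℝ} {W : ℤ → PowerSeries R} {b c : PowerSeries (PowerSeries R)}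
    (hF : Fields δ r a W b c) : ∃ u : PowerSeries R, u * coeff 0 c = 1 := by
  have h := isUnit_of_mul_isUnit_right (isUnit_mul_of_quadD hF.quad_c)
  obtain ⟨u, hu⟩ := (isUnit_constantCoeff _ h).exists_left_inv
  exact ⟨u, by simpa using hu⟩

/-- At leading order ∂ₓ y = 1 / c₀, which is positive by the choice of branch of `c`. -/
lemma isChange_of_isReciprocalVariable (h0 : (0 : ℤ) ∈ J) (hD : FinOpen J D)
    (hfib : ∀ t : Pt, Set.OrdConnected {x : ℝ | Function.update t 0 x ∈ D}) {b c : Gen} {y : Fld}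
    {B C : PowerSeries (PowerSeries (smoothRing J D))} (hB : GenRep b B) (hC : GenRep c C)
    (hB0 : coeff 0 B = 1) {U : PowerSeries (smoothRing J D)} (hU : U * coeff 0 C = 1)
    (hpos : ∀ t ∈ D, 0 < coeff 0 (coeff 0 c) t) (hy : IsReciprocalVariable J D b c y) :
    IsChange J D y := by
  refine ⟨h0, hD, hfib, hy.1 0, fun t ht => ?_⟩
  have h1 := hy.2 0 h0 0 ht
  rw [d, coeff_mk, rep_iff.mp (hB.alpha hC hB0 hU 0) 0 ⟨t, ht⟩] at h1
  rw [h1, betaD, if_pos le_rfl, Int.toNat_zero, hB0, mul_one]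
  have h2 := congrArg (fun F => (coeff 0 F).1 ⟨t, ht⟩) hU
  simp only [coeff_zero_eq_constantCoeff_apply, map_mul, map_one] at h2
  rw [← coeff_zero_eq_constantCoeff_apply, ← coeff_zero_eq_constantCoeff_apply,
    ← coeff_zero_eq_constantCoeff_apply] at h2
  have h3 : (coeff 0 U).1 ⟨t, ht⟩ * (coeff 0 (coeff 0 C)).1 ⟨t, ht⟩ = 1 := h2
  rw [← rep_iff.mp (hC 0) 0 ⟨t, ht⟩] at h3
  have h4 := hpos t ht
  exact pos_of_mul_pos_left (h3 ▸ one_pos) h4.le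

variable {y : Fld}

/-- The formal change of variables as a homomorphism of series with smooth coefficients. -/
def IsChange.formal (h : IsChange J D y) {z : PowerSeries (smoothRing J D)} (hz : X ∣ z) :
    PowerSeries (smoothRing (negTimes J) (newPoint y '' D)) →ₐ[ℝ] PowerSeries (smoothRing J D) :=
  compEps (der h.finOpen_image (zero_mem_negTimes h.zero_mem)) h.pullback hz

lemma IsChange.rep_inOldVariables (h : IsChange J D y) {z : PowerSeries (smoothRing J D)}
    (hz : X ∣ z) (hzy : Rep (y - C (coeff 0 y)) z) {f : Fld}
    {F : PowerSeries (smoothRing (negTimes J) (newPoint y '' D))} (hf : Rep f F) :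
    Rep (inOldVariables y f) (h.formal hz F) := by
  have h0' := zero_mem_negTimes h.zero_mem
  have hit (j p : ℕ) : Set.EqOn ((pd 0)^[j] (coeff p f))
      (extendZero ((der h.finOpen_image h0')^[j] (coeff p F)).1) (newPoint y '' D) := by
    induction j with
    | zero => exact (eqOn_extendZero fun t => (rep_iff.mp hf p t).symm).symm
    | succ j ih =>
      rw [Function.iterate_succ_apply', Function.iterate_succ_apply']
      exact (pd_congr h.finOpen_image h0' ih).trans (eqOn_extendZero fun t => rfl).symm
  rw [rep_iff]
  intro k t
  rw [IsChange.formal, coeff_compEps, inOldVariables, coeff_mk]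
  have hval : (∑ j ∈ Finset.range (k + 1), ∑ p ∈ Finset.HasAntidiagonal.antidiagonal k,
      ((1 / (j.factorial : ℝ)) • h.pullback ((der h.finOpen_image h0')^[j] (coeff p.1 F))) *
        coeff p.2 (z ^ j)).1 t = ∑ j ∈ Finset.range (k + 1),
      ∑ p ∈ Finset.HasAntidiagonal.antidiagonal k, (1 / (j.factorial : ℝ)) *
        (h.pullback ((der h.finOpen_image h0')^[j] (coeff p.1 F))).1 t *
        (coeff p.2 (z ^ j)).1 t := by
    simp [Finset.sum_apply, mul_assoc]
  rw [hval]
  refine Finset.sum_congr rfl fun j _ => Finset.sum_congr rfl fun p _ => ?_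
  rw [h.pullback_apply, hit j p.1 ⟨_, t.2, rfl⟩, rep_iff.mp (hzy.pow j)]

lemma rep_transformed (h0 : (0 : ℤ) ∈ J) (hD : FinOpen J D) {r : ℕ} (a : Fin (r + 1) → ℝ)
    {w : Fin r → Fld} {i : ℤ} {W : PowerSeries (smoothRing J D)} (hW : Rep (wc w i) W) {c₀ : Fld}
    {C₀ : PowerSeries (smoothRing J D)} (hc : Rep c₀ C₀) :
    Rep (transformed a w c₀ i) (transD (der hD h0) (ac a i) W C₀) :=
  ((hc.pow 2).mul hW).sub (((rep_eps.pow 2).mul (((rep_two.mul hc).mul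
    ((hc.d hD h0).d hD h0)).sub ((hc.d hD h0).pow 2))).smul _)

/-- The formal change of variables along a potential `y` of the one-form `α`: it is a bijection that
intertwines the derivations. -/
theorem exists_formal {r : ℕ} {a : ℤ → ℝ} {b c : Gen}
    {W : ℤ → PowerSeries (smoothRing J D)} {B K : PowerSeries (PowerSeries (smoothRing J D))}
    (h : IsChange J D y) (hB : GenRep b B) (hC : GenRep c K)
    (hF : Fields (der h.finOpen h.zero_mem) r a W B K) {U : PowerSeries (smoothRing J D)}
    (hU : U * coeff 0 K = 1) (hy : IsReciprocalVariable J D b c y) :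
    ∃ Φ : PowerSeries (smoothRing (negTimes J) (newPoint y '' D)) →ₐ[ℝ]
        PowerSeries (smoothRing J D),
      Function.Injective Φ ∧ Function.Surjective Φ ∧ Φ X = X ∧
      (∀ f, constantCoeff (Φ f) = h.pullback (constantCoeff f)) ∧
      (∀ f F, Rep f F → Rep (inOldVariables y f) (Φ F)) ∧
      (∀ f : PowerSeries (smoothRing (negTimes J) (newPoint y '' D)), Φ (mapDer (der h.finOpen_image (zero_mem_negTimes h.zero_mem)) f) =
        coeff 0 K * mapDer (der h.finOpen h.zero_mem) (Φ f)) ∧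
      ∀ n (hn : n ∈ J) (hn' : -n ∈ negTimes J), n ≠ 0 →
        ∀ f : PowerSeries (smoothRing (negTimes J) (newPoint y '' D)),
        Φ (mapDer (der h.finOpen_image (n := -n) hn') f) = mapDer (der h.finOpen hn) (Φ f) -
          betaD B K n * mapDer (der h.finOpen h.zero_mem) (Φ f) := by
  have h0' := zero_mem_negTimes h.zero_mem
  have hD' := h.finOpen_image
  obtain ⟨Y, hY⟩ := hy.1.exists_rep
  have hY0 : coeff 0 Y = h.smooth.toRing := by
    ext t
    exact (rep_iff.mp hY 0 t).symm
  obtain ⟨z, hzdef⟩ : ∃ z, z = Y - C (coeff 0 Y) := ⟨_, rfl⟩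
  have hz : X ∣ z := by
    rw [X_dvd_iff, hzdef, map_sub, constantCoeff_C, coeff_zero_eq_constantCoeff_apply, sub_self]
  have hzy : Rep (y - C (coeff 0 y)) z := by
    rw [hzdef]
    refine hY.sub (rep_iff.mpr fun k t => ?_)
    rw [coeff_C, coeff_C]
    split_ifs
    · exact rep_iff.mp hY 0 t
    · rfl
  have hdY {n : ℤ} (hn : n ∈ J) : mapDer (der h.finOpen hn) Y = U * betaD B K n :=
    ((hY.d h.finOpen hn).agree_iff (hB.alpha hC hF.b_zero hU n)).mp (hy.2 n hn)
  -- The chain rule for Φ has the derivative of the leading part and of the remainder `z` as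
  -- separate terms; together they form ∂ₙ y = αₙ.
  have hγ {n : ℤ} (hn : n ∈ J) : C (der h.finOpen hn h.smooth.toRing) +
      mapDer (der h.finOpen hn) z = U * betaD B K n := by
    rw [hzdef, map_sub, mapDer_C, hdY, hY0]
    ring
  have hder0 (f) : mapDer (der h.finOpen h.zero_mem) (h.formal hz f) =
      U * h.formal hz (mapDer (der hD' h0') f) := by
    -- The new variables depend on x only through y, so there is no derivative along a new time.
    have := mapDer_compEps (der hD' h0') h.pullback hz (E' := 0)
      (E := der h.finOpen h.zero_mem) (γ := der h.finOpen h.zero_mem h.smooth.toRing)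
      (by simp) (fun f => by
        have := h.der_pullback h.zero_mem f
        simpa using this) f
    rw [hγ, betaD, if_pos le_rfl, Int.toNat_zero, hF.b_zero, mul_one] at this
    have hzero : mapDer (0 : Derivation ℝ (smoothRing (negTimes J) (newPoint y '' D)) _) f = 0 := by
      ext k; simp
    rw [hzero, map_zero, zero_add] at this
    exact this
  refine ⟨h.formal hz, compEps_injective _ _ hz h.pullback_injective,
    compEps_surjective _ _ hz h.pullback_surjective, compEps_X _ _ hz,
    constantCoeff_compEps _ _ hz, fun f F => h.rep_inOldVariables hz hzy, fun f => ?_,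
    fun n hn hn' hn0 f => ?_⟩
  · rw [hder0, ← mul_assoc, mul_comm (coeff 0 K), hU, one_mul]
  · have := mapDer_compEps (der hD' h0') h.pullback hz (E' := der hD' hn')
      (E := der h.finOpen hn) (γ := der h.finOpen hn h.smooth.toRing)
      (der_comm hD' hn' h0') (fun f => by
        have := h.der_pullback hn f
        rw [if_neg hn0] at this
        exact this) f
    rw [hγ] at this
    change mapDer (der h.finOpen hn) (h.formal hz f) = h.formal hz (mapDer (der hD' hn') f) +
      U * betaD B K n * h.formal hz (mapDer (der hD' h0') f) at this
    rw [hder0, this]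
    ring

/-- Used for c'₀, whose image under Φ is 1 / c₀: the transformed negative series has the required
positive branch. -/
lemma coeff_zero_pos_of_map_eq (h : IsChange J D y)
    {Φ : PowerSeries (smoothRing (negTimes J) (newPoint y '' D)) →ₐ[ℝ]
      PowerSeries (smoothRing J D)}
    (hΦ : ∀ f, constantCoeff (Φ f) = h.pullback (constantCoeff f)) {c₀ : Fld}
    {C₀ U : PowerSeries (smoothRing J D)} (hc : Rep c₀ C₀) (hU : U * C₀ = 1)
    (hpos : ∀ t ∈ D, 0 < coeff 0 c₀ t) {f : Fld}
    {F : PowerSeries (smoothRing (negTimes J) (newPoint y '' D))} (hf : Rep f F) (hFU : Φ F = U) :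
    ∀ t ∈ newPoint y '' D, 0 < coeff 0 f t := by
  rintro _ ⟨t, ht, rfl⟩
  have h1 : coeff 0 f (newPoint y t) = (h.pullback (coeff 0 F)).1 ⟨t, ht⟩ := by
    rw [h.pullback_apply]
    exact (rep_iff.mp hf 0 ⟨_, t, ht, rfl⟩).trans
      (extendZero_apply _ (⟨_, t, ht, rfl⟩ : newPoint y '' D)).symm
  have h2 : h.pullback (coeff 0 F) = coeff 0 U := by
    rw [coeff_zero_eq_constantCoeff_apply, ← hΦ, hFU, coeff_zero_eq_constantCoeff_apply]
  have h5 := congrArg constantCoeff hU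
  rw [map_mul, map_one, ← coeff_zero_eq_constantCoeff_apply,
    ← coeff_zero_eq_constantCoeff_apply] at h5
  have h6 : (coeff 0 U).1 ⟨t, ht⟩ * (coeff 0 C₀).1 ⟨t, ht⟩ = 1 :=
    congrFun (congrArg Subtype.val h5) ⟨t, ht⟩
  rw [← rep_iff.mp hc 0 ⟨t, ht⟩] at h6
  rw [h1, h2]
  exact pos_of_mul_pos_left (h6 ▸ one_pos) (hpos t ht).le

/-- The reciprocal transformation of a solution along a potential `y` of the one-form `α`. -/
theorem reciprocal_transformation {r : ℕ} {a : Fin (r + 1) → ℝ} {w : Fin r → Fld} {b c : Gen}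
    {W : ℤ → PowerSeries (smoothRing J D)} {B K : PowerSeries (PowerSeries (smoothRing J D))}
    (h : IsChange J D y) (hW : ∀ i, Rep (wc w i) (W i)) (hB : GenRep b B) (hC : GenRep c K)
    (hF : Fields (der h.finOpen h.zero_mem) r (ac a) W B K) {U : PowerSeries (smoothRing J D)}
    (hU : U * coeff 0 K = 1) (hpos : ∀ t ∈ D, 0 < coeff 0 (coeff 0 c) t)
    (hflow : ∀ n (hn : n ∈ J), IsFlow (der h.finOpen h.zero_mem) (der h.finOpen hn) r (ac a) W B K n)
    (hy : IsReciprocalVariable J D b c y) :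
    ∃ v : Fin r → Fld, IsTransform J D a w (coeff 0 c) y v ∧
      (∀ v' : Fin r → Fld, IsTransform J D a w (coeff 0 c) y v' →
        ∀ i, Agree (newPoint y '' D) (v' i) (v i)) ∧
      IsSolution (negTimes J) (newPoint y '' D) (fun i => a (Fin.rev i)) v := by
  have h0' := zero_mem_negTimes h.zero_mem
  have hD' := h.finOpen_image
  obtain ⟨Φ, hinj, hsurj, hX, hconst, hrep, hder0, hder⟩ := exists_formal h hB hC hF hU hy
  -- Surjectivity of Φ provides the new coefficients and both new series; injectivity later gives
  -- uniqueness and transports their equations.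
  choose V hV using fun k : ℤ => hsurj (transD (der h.finOpen h.zero_mem) (ac a (r - k))
    (W (r - k)) (coeff 0 K))
  choose B' hB' using fun j => hsurj (U * coeff j K)
  choose K' hK' using fun j => hsurj (U * coeff j B)
  have hT : Transforms (der h.finOpen h.zero_mem) (der hD' h0') Φ r (ac a) W B K U V
      (PowerSeries.mk B') (PowerSeries.mk K') :=
    ⟨hinj, hX, hder0, hU, hV, fun j => by rw [coeff_mk, hB'], fun j => by rw [coeff_mk, hK']⟩
  choose v hv using fun i : Fin r => exists_rep (V (i : ℕ))
  have hvV := exists_rep_wc hv (hT.V_top hF) (fun i => hT.V_eq_zero hF)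
  obtain ⟨b', hb'⟩ := exists_genRep (PowerSeries.mk B')
  obtain ⟨c', hc'⟩ := exists_genRep (PowerSeries.mk K')
  have hac : ac (fun i => a (Fin.rev i)) = fun i => ac a (r - i) := funext (ac_rev a)
  have htr {v : Fin r → Fld} {i : ℤ}
      {F : PowerSeries (smoothRing (negTimes J) (newPoint y '' D))}
      (hF : Rep (wc v (r - i)) F) :
      Agree D (inOldVariables y (wc v (r - i))) (transformed a w (coeff 0 c) i) ↔
        Φ F = transD (der h.finOpen h.zero_mem) (ac a i) (W i) (coeff 0 K) :=
    (hrep _ _ hF).agree_iff (rep_transformed h.zero_mem h.finOpen a (hW i) (hC 0))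
  refine ⟨v, ⟨fun i => (hv i).smooth, fun i _ => ?_⟩, fun v' hv' i => ?_, fun i => (hv i).smooth,
    b', c', ⟨fun j => (hb' j).smooth, ?_, ?_⟩, ⟨fun j => (hc' j).smooth, ?_, ?_⟩, fun n hn => ?_⟩
  · rw [htr (hvV _), hV, sub_sub_cancel]
  · obtain ⟨F, hF'⟩ := (hv'.1 i).exists_rep
    -- The defining relation determines v^{r-j}; taking j = r - i isolates vⁱ.
    have h1 := hv'.2 (r - i) (by omega)
    have h2 : (r : ℤ) - ((r - i : ℕ) : ℤ) = (i : ℕ) := by omega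
    have h3 : Rep (wc v' (r - ((r - i : ℕ) : ℤ))) F := by rwa [h2, wc_coe]
    rw [htr h3, show ((r - i : ℕ) : ℤ) = r - (i : ℕ) by omega] at h1
    rw [hF'.agree_iff (hv i)]
    exact hinj (h1.trans (hV _).symm)
  · exact ((hb' 0).agree_iff rep_one).mpr hT.b_zero
  · refine ((GenRep.quad hD' h0' (genRep_mk fun j => hvV _) (genRep_mk fun j => rep_one.smul _)
      hb').agree_iff genRep_one).mpr ?_
    rw [hac]
    exact hT.quad_b hF
  · refine coeff_zero_pos_of_map_eq h hconst (hC 0) hU hpos (hc' 0) ?_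
    rw [coeff_mk, hK', hF.b_zero, mul_one]
  · refine ((GenRep.quad hD' h0' (genRep_mk fun j => hvV _) (genRep_mk fun j => rep_one.smul _)
      hc').agree_iff genRep_one).mpr ?_
    rw [hac]
    exact hT.quad_c hF
  · rw [solvesFlow_iff h0' hD' hvV hb' hc' hn, hac]
    obtain ⟨m, rfl⟩ : ∃ m, n = -m := ⟨-n, (neg_neg n).symm⟩
    have hm : m ∈ J := by simpa [negTimes] using hn
    by_cases hm0 : m = 0
    · subst hm0
      exact hT.flow_zero hF
    · exact hT.flow hF hm0 (der_comm h.finOpen h.zero_mem hm) (hflow m hm) (hder m hm hn hm0)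

end Final

end RKdVCH

end

/-! ### Assembly of the main theorem -/

theorem mainTheorem8 (r : ℕ) (a : Fin (r + 1) → ℝ)
    (J : Set ℤ) (hJ : (0 : ℤ) ∈ J)
    (D : Set RKdVCH.Pt) (hD : RKdVCH.FinOpen J D)
    (hfib : ∀ t : RKdVCH.Pt, Set.OrdConnected {x : ℝ | Function.update t 0 x ∈ D})
    (w : Fin r → RKdVCH.Fld) (b c : RKdVCH.Gen)
    (hw : ∀ i, RKdVCH.Smooth J D (w i))
    (hb : RKdVCH.IsPositiveSeries J D a w b)
    (hc : RKdVCH.IsNegativeSeries J D a w c)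
    (hflow : ∀ n ∈ J, RKdVCH.SolvesFlow D a w b c n) :
    -- the one-form `α` is closed
    (∀ m ∈ J, ∀ n ∈ J, RKdVCH.Agree D
      (RKdVCH.d m (RKdVCH.alpha b c n)) (RKdVCH.d n (RKdVCH.alpha b c m))) ∧
    -- on a convex domain it has a potential `y`
    (Convex ℝ D → ∃ y : RKdVCH.Fld, RKdVCH.IsReciprocalVariable J D b c y) ∧
    -- for each potential `y`, the pair `(y, s)` is a system of coordinates, and the functions `v`
    -- exist, are unique, and solve the flows with `n ∈ -J` of the reversed hierarchy
    ∀ y : RKdVCH.Fld, RKdVCH.IsReciprocalVariable J D b c y →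
      Set.InjOn (RKdVCH.newPoint y) D ∧
      RKdVCH.FinOpen (RKdVCH.negTimes J) (RKdVCH.newPoint y '' D) ∧
      ∃ v : Fin r → RKdVCH.Fld,
        RKdVCH.IsTransform J D a w (PowerSeries.coeff 0 c) y v ∧
        (∀ v' : Fin r → RKdVCH.Fld,
          RKdVCH.IsTransform J D a w (PowerSeries.coeff 0 c) y v' →
            ∀ i, RKdVCH.Agree (RKdVCH.newPoint y '' D) (v' i) (v i)) ∧
        RKdVCH.IsSolution (RKdVCH.negTimes J) (RKdVCH.newPoint y '' D)
          (fun i => a (Fin.rev i)) v := by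
  obtain ⟨W, B, C, hW, hB, hC, hF⟩ := RKdVCH.exists_fields hJ hD hw hb hc
  obtain ⟨U, hU⟩ := hF.exists_inverse
  have hfl (n : ℤ) (hn : n ∈ J) :
      RKdVCH.IsFlow (RKdVCH.der hD hJ) (RKdVCH.der hD hn) r (RKdVCH.ac a) W B C n :=
    (RKdVCH.solvesFlow_iff hJ hD hW hB hC hn).mp (hflow n hn)
  have hα (n : ℤ) := hB.alpha hC hF.b_zero hU n
  have hclosed : ∀ m ∈ J, ∀ n ∈ J, RKdVCH.Agree D
      (RKdVCH.d m (RKdVCH.alpha b c n)) (RKdVCH.d n (RKdVCH.alpha b c m)) := fun m hm n hn =>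
    (((hα n).d hD hm).agree_iff ((hα m).d hD hn)).mpr
      (hF.closed (RKdVCH.der_comm hD hJ hm) (RKdVCH.der_comm hD hJ hn) (hfl m hm) (hfl n hn) hU)
  refine ⟨hclosed, fun hconv => ?_, fun y hy => ?_⟩
  · have hs (k : ℕ) : ∀ n ∈ J, RKdVCH.SmoothFun J D (PowerSeries.coeff k (RKdVCH.alpha b c n)) :=
      fun n _ => (hα n).smooth k
    have hcl (k : ℕ) : ∀ m ∈ J, ∀ n ∈ J,
        Set.EqOn (RKdVCH.pd m (PowerSeries.coeff k (RKdVCH.alpha b c n)))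
          (RKdVCH.pd n (PowerSeries.coeff k (RKdVCH.alpha b c m))) D := fun m hm n hn => by
      have := hclosed m hm n hn k
      rwa [RKdVCH.d, RKdVCH.d, PowerSeries.coeff_mk, PowerSeries.coeff_mk] at this
    -- Each power of ε is an ordinary closed one-form, so the potential is built order by order.
    refine ⟨PowerSeries.mk fun k =>
      RKdVCH.potential J D fun n => PowerSeries.coeff k (RKdVCH.alpha b c n), fun k => ?_,
      fun n hn k => ?_⟩
    · rw [PowerSeries.coeff_mk]
      exact RKdVCH.smoothFun_potential hD hconv (hs k) (hcl k)
    · rw [RKdVCH.d, PowerSeries.coeff_mk, PowerSeries.coeff_mk]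
      exact RKdVCH.pd_potential hD hconv (hs k) (hcl k) hn
  · have hch := RKdVCH.isChange_of_isReciprocalVariable hJ hD hfib hB hC hF.b_zero hU hc.2.1 hy
    exact ⟨hch.injOn, hch.finOpen_image,
      RKdVCH.reciprocal_transformation hch hW hB hC hF hU hc.2.1 hfl hy⟩
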